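/- Let $K$ be a (real, finite-dimensional) Lie group with Lie algebra $\mathfrak k$, equipped with an inner product $\langle\cdot,\cdot\rangle$ on $\mathfrak k$ invariant under the adjoint action (such an inner product exists if $K$ is compact). Let $M$, $P$ be smooth finite-dimensional Hausdorff manifolds without boundary, and let $\pi:P\to M$ be a smooth principal $K$-bundle (right action) with a connection $A$, with connection form $\omega_A$, horizontal spaces $A_p=\ker(\omega_A)_p$ and fundamental vector fields $X^\#$ ($X\in\mathfrak k$). Let $\alpha$ be a smooth tensorial $1$-form of type $\mathrm{ad}$ on $P$ with values in $\mathfrak k$ (it vanishes on vertical vectors and $R_k^*\alpha=\mathrm{Ad}_{k^{-1}}\alpha$) such that $\alpha_p|_{A_p}:A_p\to\mathfrak k$ is an isomorphism for every $p\in P$. Let $J_\alpha$ be the almost complex structure on $P$ with $J_\alpha w=(\alpha_p(w))^\#_p$ for $w\in A_p$ and $J_\alpha X^\#_p=-(\alpha_p|_{A_p})^{-1}(X)$ for $X\in\mathfrak k$. Let $g_\alpha$ be the Riemannian metric on $M$ given by $g_\alpha(u,v)=\langle\alpha_p(\tilde u),\alpha_p(\tilde v)\rangle$ for $u,v\in T_xM$,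 where $p\in\pi^{-1}(x)$ and $\tilde u,\tilde v\in T_pP$ are lifts of $u,v$. Assume that $d_A\alpha=0$, where $d_A\alpha(\zeta,\xi)=d\alpha(\pi_A\zeta,\pi_A\xi)$ and $\pi_A:TP\to A$ is the projection along the vertical bundle (integrability of $J_\alpha$ is not assumed). Then the following are equivalent: (i) For every $X\in\mathfrak k$ the vector field $X^\#-iJ_\alpha X^\#$ is completely integrable, i.e. for every $p\in P$ there is a smooth map $\varphi:\mathbb C\to P$ with $\varphi(0)=p$ and $$\varphi_*\Big(\frac{\partial}{\partial z}\Big)=\tfrac12\big(X^\#-iJ_\alpha X^\#\big)\quad\text{along }\varphi,\qquad \frac{\partial}{\partial z}=\tfrac12\Big(\frac{\partial}{\partial x}-i\frac{\partial}{\partial y}\Big).$$ (ii) $(M,g_\alpha)$ is geodesically complete, i.e. every geodesic of the Levi-Civita connection of $g_\alpha$ defined on an open interval extends to a geodesic defined on all of $\mathbb R$. -/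

import Mathlib

open scoped Manifold ContDiff TensorProduct RightActions
open Bundle

noncomputable section

namespace PrincipalComplex

/-! ### Principal bundles, connections and tensorial forms

`K` is a real Lie group modelled on `EK`, `M` and `P` are smooth manifolds modelled on `EM`, `EP`.
A right action of `K` on `P` is an action of `Kᵐᵒᵖ`, and `p <• k` is `p` moved by `k`. -/

section Bundles

set_option linter.unusedSectionVars false

variable {EK EM EP : Type*}
  [NormedAddCommGroup EK] [NormedSpace ℝ EK]
  [NormedAddCommGroup EM] [NormedSpace ℝ EM]
  [NormedAddCommGroup EP] [NormedSpace ℝ EP]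
  {K M P : Type*} [TopologicalSpace K] [ChartedSpace EK K] [Group K]
  [TopologicalSpace M] [ChartedSpace EM M]
  [TopologicalSpace P] [ChartedSpace EP P] [IsManifold 𝓘(ℝ, EP) ∞ P]
  [MulAction Kᵐᵒᵖ P]

/-- `pr : P → M` is a smooth principal fibre bundle with structure group `K` acting from the right:
the action is smooth and preserves the fibres, and `pr` is locally isomorphic, smoothly and
`K`-equivariantly, to `U × K → U`. In particular the action is free, and transitive on fibres. -/
structure IsPrincipalBundle (EK EM EP : Type*)
    [NormedAddCommGroup EK] [NormedSpace ℝ EK]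
    [NormedAddCommGroup EM] [NormedSpace ℝ EM]
    [NormedAddCommGroup EP] [NormedSpace ℝ EP]
    (K : Type*) {M P : Type*} [TopologicalSpace K] [ChartedSpace EK K] [Group K]
    [TopologicalSpace M] [ChartedSpace EM M]
    [TopologicalSpace P] [ChartedSpace EP P] [MulAction Kᵐᵒᵖ P] (pr : P → M) : Prop where
  smooth_proj : ContMDiff 𝓘(ℝ, EP) 𝓘(ℝ, EM) ∞ pr
  smooth_action : ContMDiff (𝓘(ℝ, EP).prod 𝓘(ℝ, EK)) 𝓘(ℝ, EP) ∞ (fun q : P × K => q.1 <• q.2)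
  proj_action : ∀ (p : P) (k : K), pr (p <• k) = pr p
  locally_trivial : ∀ x : M, ∃ e : Trivialization K pr, x ∈ e.baseSet ∧
    ContMDiffOn 𝓘(ℝ, EP) (𝓘(ℝ, EM).prod 𝓘(ℝ, EK)) ∞ e e.source ∧
    ContMDiffOn (𝓘(ℝ, EM).prod 𝓘(ℝ, EK)) 𝓘(ℝ, EP) ∞ e.toOpenPartialHomeomorph.symm e.target ∧
    ∀ p ∈ e.source, ∀ k : K, (e (p <• k)).2 = (e p).2 * k

/-- The adjoint representation: `Ad g` is the derivative at `1` of `h ↦ g h g⁻¹`. -/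
def Ad (g : K) : GroupLieAlgebra 𝓘(ℝ, EK) K →L[ℝ] GroupLieAlgebra 𝓘(ℝ, EK) K :=
  mfderiv 𝓘(ℝ, EK) 𝓘(ℝ, EK) (fun h : K => g * h * g⁻¹) 1

/-- The fundamental vector field `X^#` at `p`: the derivative at `1` of `k ↦ p k`, applied
to `X`. -/
def fundamental (p : P) : GroupLieAlgebra 𝓘(ℝ, EK) K →L[ℝ] TangentSpace 𝓘(ℝ, EP) p :=
  mfderiv 𝓘(ℝ, EK) 𝓘(ℝ, EP) (fun k : K => p <• k) 1

/-- The derivative at `p` of the right translation `R_k`. -/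
def rightTranslation (EP : Type*) [NormedAddCommGroup EP] [NormedSpace ℝ EP] [ChartedSpace EP P]
    (k : K) (p : P) : TangentSpace 𝓘(ℝ, EP) p →L[ℝ] TangentSpace 𝓘(ℝ, EP) (p <• k) :=
  mfderiv 𝓘(ℝ, EP) 𝓘(ℝ, EP) (fun q : P => q <• k) p

/-- A smooth `1`-form on `P` with values in the Lie algebra of `K`. -/
structure LieForm (EK EP : Type*)
    [NormedAddCommGroup EK] [NormedSpace ℝ EK] [NormedAddCommGroup EP] [NormedSpace ℝ EP]
    (K P : Type*) [TopologicalSpace K] [ChartedSpace EK K] [Group K]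
    [TopologicalSpace P] [ChartedSpace EP P] [IsManifold 𝓘(ℝ, EP) ∞ P] where
  toFun : ∀ p : P, TangentSpace 𝓘(ℝ, EP) p →L[ℝ] GroupLieAlgebra 𝓘(ℝ, EK) K
  smooth : ContMDiff (M' := EK) 𝓘(ℝ, EP).tangent 𝓘(ℝ, EK) ∞
    (fun v : TangentBundle 𝓘(ℝ, EP) P => toFun v.1 v.2)

/-- Equivariance `R_k^* β = Ad(k⁻¹) β`, i.e. `β` is of type ad. -/
def LieForm.IsTypeAd (β : LieForm EK EP K P) : Prop :=
  ∀ (k : K) (p : P) (v : TangentSpace 𝓘(ℝ, EP) p),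
    β.toFun (p <• k) (rightTranslation EP k p v) = Ad k⁻¹ (β.toFun p v)

/-- A `1`-form is the connection form of a connection on `P` if it reproduces the generators of the
fundamental vector fields and is of type ad. The horizontal space `A_p` is its kernel at `p`. -/
structure LieForm.IsConnection (θ : LieForm EK EP K P) : Prop where
  fundamental : ∀ (p : P) (X : GroupLieAlgebra 𝓘(ℝ, EK) K), θ.toFun p (fundamental p X) = X
  typeAd : θ.IsTypeAd

/-- Tensorial `1`-forms of type ad: those of type ad that vanish on vertical vectors. -/
structure LieForm.IsTensorial (EM : Type*) [NormedAddCommGroup EM] [NormedSpace ℝ EM]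
    [ChartedSpace EM M] (pr : P → M) (α : LieForm EK EP K P) : Prop where
  vertical : ∀ (p : P) (v : TangentSpace 𝓘(ℝ, EP) p),
    mfderiv 𝓘(ℝ, EP) 𝓘(ℝ, EM) pr p v = 0 → α.toFun p v = 0
  typeAd : α.IsTypeAd

/-- The horizontal space `A_p` of the connection with connection form `θ`. -/
def horizontal (θ : LieForm EK EP K P) (p : P) : Submodule ℝ (TangentSpace 𝓘(ℝ, EP) p) :=
  LinearMap.ker (θ.toFun p).toLinearMap

/-- The restriction `α_p : A_p → 𝔨`. -/
def restrictHorizontal (θ α : LieForm EK EP K P) (p : P) :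
    horizontal θ p →ₗ[ℝ] GroupLieAlgebra 𝓘(ℝ, EK) K :=
  (α.toFun p).toLinearMap.domRestrict (horizontal θ p)

/-! ### The almost complex structure -/

/-- The inverse `α_p⁻¹ : 𝔨 → A_p ⊆ T_p P`. -/
def alphaInv (θ α : LieForm EK EP K P)
    (hα : ∀ p, Function.Bijective (restrictHorizontal θ α p)) (p : P) :
    GroupLieAlgebra 𝓘(ℝ, EK) K →ₗ[ℝ] TangentSpace 𝓘(ℝ, EP) p :=
  (horizontal θ p).subtype ∘ₗ (LinearEquiv.ofBijective (restrictHorizontal θ α p) (hα p)).symm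

/-- The almost complex structure `J_α`: a vector `w + X^#` with `w` horizontal is sent to
`(α w)^# - α⁻¹ X`. -/
def almostComplex (θ α : LieForm EK EP K P)
    (hα : ∀ p, Function.Bijective (restrictHorizontal θ α p)) (p : P) :
    TangentSpace 𝓘(ℝ, EP) p →ₗ[ℝ] TangentSpace 𝓘(ℝ, EP) p :=
  (fundamental p).toLinearMap ∘ₗ (α.toFun p).toLinearMap
    - alphaInv θ α hα p ∘ₗ (θ.toFun p).toLinearMap

/-- The section `X^# - i J_α X^#` of the complexified tangent bundle `ℂ ⊗ TP`. -/
def holField (θ α : LieForm EK EP K P)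
    (hα : ∀ p, Function.Bijective (restrictHorizontal θ α p))
    (X : GroupLieAlgebra 𝓘(ℝ, EK) K) (p : P) : ℂ ⊗[ℝ] TangentSpace 𝓘(ℝ, EP) p :=
  (1 : ℂ) ⊗ₜ[ℝ] (fundamental p X : TangentSpace 𝓘(ℝ, EP) p)
    - Complex.I ⊗ₜ[ℝ] almostComplex θ α hα p (fundamental p X)

/-- The complex tangent vector `∂/∂z = ½ (∂/∂x - i ∂/∂y)` of `ℂ` at `z`. -/
def ddz (z : ℂ) : ℂ ⊗[ℝ] TangentSpace 𝓘(ℝ, ℂ) z :=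
  (1 / 2 : ℂ) • ((1 : ℂ) ⊗ₜ[ℝ] (show TangentSpace 𝓘(ℝ, ℂ) z from (1 : ℂ))
    - Complex.I ⊗ₜ[ℝ] (show TangentSpace 𝓘(ℝ, ℂ) z from Complex.I))

/-- A complex vector field `Z` on `P` is completely integrable if through every point `p` there is
a smooth map `φ : ℂ → P` with `φ 0 = p` and `φ_* (∂/∂z) = ½ Z` along `φ`. -/
def CompletelyIntegrable (Z : ∀ p : P, ℂ ⊗[ℝ] TangentSpace 𝓘(ℝ, EP) p) : Prop :=
  ∀ p : P, ∃ φ : ℂ → P, ContMDiff 𝓘(ℝ, ℂ) 𝓘(ℝ, EP) ∞ φ ∧ φ 0 = p ∧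
    ∀ z : ℂ, (mfderiv 𝓘(ℝ, ℂ) 𝓘(ℝ, EP) φ z).toLinearMap.baseChange ℂ (ddz z)
      = (1 / 2 : ℂ) • Z (φ z)

/-! ### The covariant exterior derivative -/

/-- The `1`-form `β` written in the chart of `P` at `p₀`. -/
def inChart (β : LieForm EK EP K P) (p₀ : P) (y : EP) : EP →L[ℝ] EK :=
  (β.toFun ((extChartAt 𝓘(ℝ, EP) p₀).symm y)).comp
    (mfderiv 𝓘(ℝ, EP) 𝓘(ℝ, EP) (extChartAt 𝓘(ℝ, EP) p₀).symm y)

/-- The exterior derivative `dβ(u, v) = ∂_u (β v) - ∂_v (β u)` at `p`, computed in the chart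
at `p`. -/
def extDer (β : LieForm EK EP K P) (p : P) (u v : TangentSpace 𝓘(ℝ, EP) p) : EK :=
  let D : EP → EP → EK := fun a b => fderiv ℝ (inChart β p) (extChartAt 𝓘(ℝ, EP) p p) a b
  let c : TangentSpace 𝓘(ℝ, EP) p → EP :=
    fun w => mfderiv 𝓘(ℝ, EP) 𝓘(ℝ, EP) (extChartAt 𝓘(ℝ, EP) p) p w
  D (c u) (c v) - D (c v) (c u)

/-- The projection of `T_p P` onto the horizontal space along the vertical space. -/
def horProj (θ : LieForm EK EP K P) (p : P) (v : TangentSpace 𝓘(ℝ, EP) p) :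
    TangentSpace 𝓘(ℝ, EP) p :=
  v - fundamental p (θ.toFun p v)

/-- The covariant exterior derivative `d_A β`, i.e. `dβ` precomposed with the horizontal
projection. -/
def covExtDer (θ β : LieForm EK EP K P) (p : P) (u v : TangentSpace 𝓘(ℝ, EP) p) : EK :=
  extDer β p (horProj θ p u) (horProj θ p v)

/-! ### The induced metric on the base -/

/-- An inner product on the Lie algebra of `K` that is invariant under the adjoint action. -/
structure AdInner (EK : Type*) [NormedAddCommGroup EK] [NormedSpace ℝ EK]
    (K : Type*) [TopologicalSpace K] [ChartedSpace EK K] [Group K] where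
  form : LinearMap.BilinForm ℝ (GroupLieAlgebra 𝓘(ℝ, EK) K)
  symm : ∀ X Y, form X Y = form Y X
  pos : ∀ X, X ≠ 0 → 0 < form X X
  invariant : ∀ (g : K) (X Y), form (Ad g X) (Ad g Y) = form X Y

theorem IsPrincipalBundle.surjective {pr : P → M} (h : IsPrincipalBundle EK EM EP K pr) :
    Function.Surjective pr := by
  intro x
  obtain ⟨e, hx, -⟩ := h.locally_trivial x
  exact ⟨e.toOpenPartialHomeomorph.symm (x, 1), e.proj_symm_apply' hx⟩

theorem IsPrincipalBundle.mfderiv_surjective {pr : P → M} (h : IsPrincipalBundle EK EM EP K pr)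
    (p : P) : Function.Surjective (mfderiv 𝓘(ℝ, EP) 𝓘(ℝ, EM) pr p) := by
  obtain ⟨e, hx, -, hsymm, -⟩ := h.locally_trivial (pr p)
  have hp : p ∈ e.source := e.mem_source.2 hx
  let σ : M → P := fun x => e.toOpenPartialHomeomorph.symm (x, (e p).2)
  have hσp : σ (pr p) = p := e.symm_apply_mk_proj hp
  have hmem : (pr p, (e p).2) ∈ e.target := e.mem_target.2 hx
  have hσ : MDifferentiableAt 𝓘(ℝ, EM) 𝓘(ℝ, EP) σ (pr p) := by
    have h1 : ContMDiffAt (𝓘(ℝ, EM).prod 𝓘(ℝ, EK)) 𝓘(ℝ, EP) ∞ e.toOpenPartialHomeomorph.symm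
        (pr p, (e p).2) :=
      (hsymm _ hmem).contMDiffAt (e.open_target.mem_nhds hmem)
    have h2 : ContMDiffAt 𝓘(ℝ, EM) (𝓘(ℝ, EM).prod 𝓘(ℝ, EK)) ∞
        (fun x : M => (x, (e p).2)) (pr p) := contMDiffAt_id.prodMk contMDiffAt_const
    exact (h1.comp (pr p) h2).mdifferentiableAt (by simp)
  have hpr : MDifferentiableAt 𝓘(ℝ, EP) 𝓘(ℝ, EM) pr (σ (pr p)) :=
    h.smooth_proj.mdifferentiable (by simp) _
  have hcomp : (pr ∘ σ) =ᶠ[nhds (pr p)] id := by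
    filter_upwards [e.open_baseSet.mem_nhds hx] with x hx'
    exact e.proj_symm_apply' hx'
  have key := mfderiv_comp (pr p) hpr hσ
  rw [hcomp.mfderiv_eq, mfderiv_id] at key
  intro u
  rw [← hσp]
  exact ⟨mfderiv 𝓘(ℝ, EM) 𝓘(ℝ, EP) σ (pr p) u, (congrArg (fun L => L u) key).symm⟩

/-- The pullback of the inner product along `T_x M → 𝔨, u ↦ α_p ũ`, where `x = pr p` and `ũ` is a
lift of `u` to `T_p P`. -/
def metricAt {pr : P → M} (h : IsPrincipalBundle EK EM EP K pr) (α : LieForm EK EP K P)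
    (B : AdInner EK K) (p : P) (u v : TangentSpace 𝓘(ℝ, EM) (pr p)) : ℝ :=
  B.form (α.toFun p (Function.surjInv (h.mfderiv_surjective p) u))
    (α.toFun p (Function.surjInv (h.mfderiv_surjective p) v))

/-- The metric `g_α` on `M`, which makes `TM → ad(P)`, `u ↦ [p, α_p ũ]` an isometry:
`g_α(u, v) = ⟨α_p ũ, α_p ṽ⟩` for `u, v ∈ T_x M`, a point `p` over `x` and lifts `ũ, ṽ ∈ T_p P`.
By `inducedMetric_apply` below the choices do not matter. -/
def inducedMetric {pr : P → M} (h : IsPrincipalBundle EK EM EP K pr) (α : LieForm EK EP K P)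
    (B : AdInner EK K) (x : M) (u v : TangentSpace 𝓘(ℝ, EM) x) : ℝ :=
  have hp : x = pr (Function.surjInv h.surjective x) := (Function.surjInv_eq h.surjective x).symm
  metricAt h α B (Function.surjInv h.surjective x) (hp ▸ u) (hp ▸ v)

theorem IsPrincipalBundle.exists_action_eq {pr : P → M} (h : IsPrincipalBundle EK EM EP K pr)
    {p q : P} (hpq : pr q = pr p) : ∃ k : K, q = p <• k := by
  obtain ⟨e, hx, -, -, he⟩ := h.locally_trivial (pr p)
  have hp : p ∈ e.source := e.mem_source.2 hx
  have hq : q ∈ e.source := e.mem_source.2 (hpq ▸ hx)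
  refine ⟨(e p).2⁻¹ * (e q).2, ?_⟩
  have hs : p <• ((e p).2⁻¹ * (e q).2) ∈ e.source :=
    e.mem_source.2 (by rw [h.proj_action]; exact hx)
  apply e.injOn hq hs
  refine Prod.ext ?_ ?_
  · exact (e.coe_fst hq).trans (((e.coe_fst hs).trans (h.proj_action _ _)).trans hpq.symm).symm
  · exact ((he p hp _).trans (mul_inv_cancel_left _ _)).symm

theorem IsPrincipalBundle.mfderiv_rightTranslation {pr : P → M}
    (h : IsPrincipalBundle EK EM EP K pr) (k : K) (p : P) (v : TangentSpace 𝓘(ℝ, EP) p) :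
    (mfderiv 𝓘(ℝ, EP) 𝓘(ℝ, EM) pr (p <• k) (rightTranslation EP k p v) : EM)
      = (mfderiv 𝓘(ℝ, EP) 𝓘(ℝ, EM) pr p v : EM) := by
  have h1 : MDifferentiableAt 𝓘(ℝ, EP) 𝓘(ℝ, EP) (fun q : P => q <• k) p := by
    have : ContMDiff 𝓘(ℝ, EP) 𝓘(ℝ, EP) ∞ (fun q : P => q <• k) :=
      h.smooth_action.comp (contMDiff_id.prodMk contMDiff_const)
    exact this.mdifferentiable (by simp) p
  have h2 : MDifferentiableAt 𝓘(ℝ, EP) 𝓘(ℝ, EM) pr (p <• k) :=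
    h.smooth_proj.mdifferentiable (by simp) _
  have hc : pr ∘ (fun q : P => q <• k) = pr := by
    ext q
    exact h.proj_action q k
  have h3 : HasMFDerivAt 𝓘(ℝ, EP) 𝓘(ℝ, EM) (pr ∘ fun q : P => q <• k) p _ :=
    h2.hasMFDerivAt.comp p h1.hasMFDerivAt
  rw [hc] at h3
  exact (congrArg (fun L : TangentSpace 𝓘(ℝ, EP) p →L[ℝ] EM => L v) h3.mfderiv).symm

theorem inducedMetric_apply {pr : P → M} (h : IsPrincipalBundle EK EM EP K pr)
    {α : LieForm EK EP K P} (hα : α.IsTensorial EM pr) (B : AdInner EK K) (p : P)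
    (u v : TangentSpace 𝓘(ℝ, EP) p) :
    inducedMetric h α B (pr p) (mfderiv 𝓘(ℝ, EP) 𝓘(ℝ, EM) pr p u)
      (mfderiv 𝓘(ℝ, EP) 𝓘(ℝ, EM) pr p v) = B.form (α.toFun p u) (α.toFun p v) := by
  have main : ∀ (q : P) (hq : pr p = pr q),
      metricAt h α B q (hq ▸ mfderiv 𝓘(ℝ, EP) 𝓘(ℝ, EM) pr p u)
        (hq ▸ mfderiv 𝓘(ℝ, EP) 𝓘(ℝ, EM) pr p v) = B.form (α.toFun p u) (α.toFun p v) := by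
    intro q hq
    obtain ⟨k, rfl⟩ := h.exists_action_eq hq.symm
    have cast_eq : ∀ (x y : M) (e : x = y) (w : TangentSpace 𝓘(ℝ, EM) x),
        ((e ▸ w : TangentSpace 𝓘(ℝ, EM) y) : EM) = (w : EM) := by
      rintro x _ rfl w
      rfl
    have key : ∀ w : TangentSpace 𝓘(ℝ, EP) p,
        α.toFun (p <• k) (Function.surjInv (h.mfderiv_surjective (p <• k))
          (hq ▸ mfderiv 𝓘(ℝ, EP) 𝓘(ℝ, EM) pr p w)) = Ad k⁻¹ (α.toFun p w) := by
      intro w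
      rw [← hα.typeAd, ← sub_eq_zero, ← map_sub]
      apply hα.vertical
      rw [map_sub, sub_eq_zero]
      refine (Function.surjInv_eq (h.mfderiv_surjective (p <• k)) _).trans ?_
      exact (cast_eq _ _ hq _).trans (h.mfderiv_rightTranslation k p w).symm
    unfold metricAt
    rw [key u, key v, B.invariant]
  exact main _ _

end Bundles

/-! ### Geodesics -/

section Geodesics

variable {EM : Type*} [NormedAddCommGroup EM] [NormedSpace ℝ EM]
  {M : Type*} [TopologicalSpace M] [ChartedSpace EM M]

/-- The coefficients of the metric `g` in the chart at `x₀`. -/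
def metricInChart (g : ∀ x : M, TangentSpace 𝓘(ℝ, EM) x → TangentSpace 𝓘(ℝ, EM) x → ℝ)
    (x₀ : M) (y u v : EM) : ℝ :=
  let ψ := (extChartAt 𝓘(ℝ, EM) x₀).symm
  g (ψ y) (mfderiv 𝓘(ℝ, EM) 𝓘(ℝ, EM) ψ y u) (mfderiv 𝓘(ℝ, EM) 𝓘(ℝ, EM) ψ y v)

/-- The Christoffel symbols of the first kind of the Levi-Civita connection of `g` in the chart at
`x₀`, that is `g(∇_u v, w)` for constant `u, v, w`:
`½ (∂_u g(v, w) + ∂_v g(u, w) - ∂_w g(u, v))`. -/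
def christoffel (g : ∀ x : M, TangentSpace 𝓘(ℝ, EM) x → TangentSpace 𝓘(ℝ, EM) x → ℝ)
    (x₀ : M) (y u v w : EM) : ℝ :=
  (1 / 2) * (fderiv ℝ (fun z => metricInChart g x₀ z v w) y u
    + fderiv ℝ (fun z => metricInChart g x₀ z u w) y v
    - fderiv ℝ (fun z => metricInChart g x₀ z u v) y w)

/-- `γ` is a geodesic of `g` on `s`: it is smooth there and, for every `t ∈ s`, its expression `c`
in the chart at `γ t` satisfies the geodesic equation `∇_{c'} c' = 0` of the Levi-Civita connection
at `t`, here paired with an arbitrary vector `w`: `g(c'', w) + Γ(c', c'; w) = 0`. -/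
def IsGeodesicOn (g : ∀ x : M, TangentSpace 𝓘(ℝ, EM) x → TangentSpace 𝓘(ℝ, EM) x → ℝ)
    (γ : ℝ → M) (s : Set ℝ) : Prop :=
  ContMDiffOn 𝓘(ℝ, ℝ) 𝓘(ℝ, EM) ∞ γ s ∧
    ∀ t ∈ s, let c : ℝ → EM := fun τ => extChartAt 𝓘(ℝ, EM) (γ t) (γ τ)
      ∀ w : EM, metricInChart g (γ t) (c t) (deriv (deriv c) t) w
        + christoffel g (γ t) (c t) (deriv c t) (deriv c t) w = 0

/-- `(M, g)` is geodesically complete: every geodesic defined on an open interval extends to a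
geodesic defined on the whole real line. -/
def GeodesicallyComplete
    (g : ∀ x : M, TangentSpace 𝓘(ℝ, EM) x → TangentSpace 𝓘(ℝ, EM) x → ℝ) : Prop :=
  ∀ (s : Set ℝ) (γ : ℝ → M), IsOpen s → s.OrdConnected → s.Nonempty → IsGeodesicOn g γ s →
    ∃ γ' : ℝ → M, IsGeodesicOn g γ' Set.univ ∧ Set.EqOn γ' γ s

end Geodesics

end PrincipalComplex

end

/-! Both conditions say that every standard horizontal field `alphaInv X`, i.e. `p ↦ α_p⁻¹ X` with
values in the horizontal spaces, has integral curves defined for all time.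

Condition (i). Since `J X^# = -α⁻¹ X`, a map `φ` as in (i) satisfies `∂φ/∂x = X^#` and `∂φ/∂y = -α⁻¹
X`. Hence `y ↦ φ(-iy)` is a complete integral curve of `α⁻¹ X`. Conversely, for a complete integral
curve `c` and the one-parameter subgroup `k` of `X`, put `φ(x + iy) = c(-y) k(x)`. The `y`-equation
survives translation by `k(x)` because `R_k` carries `α⁻¹ X` to `α⁻¹ (Ad k⁻¹ X)` and `Ad (k x)⁻¹ X =
X`; the vanishing of `d_A α` plays no role here.

Condition (ii). The form `α` identifies `TM` with `ad P`. The connection induced by `A` is metric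
because the inner product is `Ad`-invariant, and its torsion is `d_A α = 0`, so it is the
Levi-Civita connection. Integral curves of `α⁻¹ X` therefore project to geodesics
(`isGeodesicOn_proj`, through the chart computation `geodesicDefect_frame`). Every initial velocity
in `M` arises this way, so by uniqueness each geodesic is locally such a projection.

If the fields are complete, geodesics thus extend to all times. If geodesics are complete, extend
the projection of an integral curve to a geodesic `γ` on the line. Near any time `b`, `γ` lifts to
some horizontal integral curve, and a right translate of that lift continues every integral curve
over `γ` past `b`. The length of the continuation depends on `b` only, so integral curves never stop
(`exists_isMIntegralCurve_of_extension`). -/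

namespace PrincipalComplex

/-! ### The geodesic equation on a vector space: change of coordinates and moving frames. -/

section Calculus

open Filter Topology

variable {E E' EK EP : Type*} [NormedAddCommGroup E] [NormedSpace ℝ E]
  [NormedAddCommGroup E'] [NormedSpace ℝ E']
  [NormedAddCommGroup EK] [NormedSpace ℝ EK] [NormedAddCommGroup EP] [NormedSpace ℝ EP]

/-- The left hand side `g(a, w) + Γ(u, u; w)` of the geodesic equation for the metric `g` on a
vector space, for a curve at `y` with velocity `u` and acceleration `a`. -/
noncomputable def geodesicDefect (g : E → E → E → ℝ) (y u a w : E) : ℝ :=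
  g y a w + (1 / 2) * (fderiv ℝ (fun z => g z u w) y u
    + fderiv ℝ (fun z => g z u w) y u - fderiv ℝ (fun z => g z u u) y w)

theorem geodesicDefect_congr {g g' : E → E → E → ℝ} {y : E}
    (h : ∀ᶠ z in 𝓝 y, ∀ u v, g z u v = g' z u v) (u a w : E) :
    geodesicDefect g y u a w = geodesicDefect g' y u a w := by
  have h1 : ∀ u v, fderiv ℝ (fun z => g z u v) y = fderiv ℝ (fun z => g' z u v) y := fun u v =>
    Filter.EventuallyEq.fderiv_eq (h.mono fun z hz => hz u v)
  simp only [geodesicDefect, h1, h.self_of_nhds]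

theorem fderiv_bilin_apply {G : E → E →L[ℝ] E →L[ℝ] ℝ} {y : E} (hG : DifferentiableAt ℝ G y)
    (u v h : E) : fderiv ℝ (fun z => G z u v) y h = fderiv ℝ G y h u v := by
  have h1 : HasFDerivAt (fun z => G z u v) _ y :=
    ((hG.hasFDerivAt.clm_apply (hasFDerivAt_const u y)).clm_apply (hasFDerivAt_const v y))
  rw [h1.fderiv]
  simp

theorem geodesicDefect_bilin {G : E → E →L[ℝ] E →L[ℝ] ℝ} {y : E} (hG : DifferentiableAt ℝ G y)
    (u a w : E) : geodesicDefect (fun z u v => G z u v) y u a w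
      = G y a w + fderiv ℝ G y u u w - (1 / 2) * fderiv ℝ G y w u u := by
  simp only [geodesicDefect, fderiv_bilin_apply hG]
  ring

set_option synthInstance.maxHeartbeats 200000 in
/-- The derivative of `y ↦ G (F y) (U y) (V y)`. -/
theorem hasFDerivAt_bilin_comp {G : E' → E' →L[ℝ] E' →L[ℝ] ℝ} {F U V : E → E'} {y : E}
    {F' U' V' : E →L[ℝ] E'} (hG : DifferentiableAt ℝ G (F y)) (hF : HasFDerivAt F F' y)
    (hU : HasFDerivAt U U' y) (hV : HasFDerivAt V V' y) (h : E) :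
    fderiv ℝ (fun z => G (F z) (U z) (V z)) y h
      = fderiv ℝ G (F y) (F' h) (U y) (V y) + G (F y) (U' h) (V y) + G (F y) (U y) (V' h) := by
  have h0 : HasFDerivAt (fun z => G (F z)) ((fderiv ℝ G (F y)).comp F') y :=
    HasFDerivAt.comp (g := G) y hG.hasFDerivAt hF
  have h1 : HasFDerivAt (fun z => G (F z) (U z) (V z)) _ y := (h0.clm_apply hU).clm_apply hV
  rw [h1.fderiv]
  simp
  ring

theorem ContDiffAt.hasFDerivAt_fderiv_apply {F : E → E'} {y : E} (hF : ContDiffAt ℝ 2 F y)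
    (u : E) : HasFDerivAt (fun z => fderiv ℝ F z u) ((fderiv ℝ (fderiv ℝ F) y).flip u) y := by
  have h1 : DifferentiableAt ℝ (fderiv ℝ F) y :=
    (hF.fderiv_right (m := 1) (by norm_num)).differentiableAt (by norm_num)
  have h2 := h1.hasFDerivAt.clm_apply (hasFDerivAt_const u y)
  convert h2 using 1
  ext h
  simp

theorem fderiv_fderiv_comm {F : E → E'} {y : E} (hF : ContDiffAt ℝ 2 F y) (u v : E) :
    fderiv ℝ (fderiv ℝ F) y u v = fderiv ℝ (fderiv ℝ F) y v u :=
  (hF.isSymmSndFDerivAt (by simp)).eq u v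

/-- The second derivative of a composition with a curve. -/
theorem deriv_deriv_comp {F : E → E'} {c : ℝ → E} {t : ℝ} (hF : ContDiffAt ℝ 2 F (c t))
    (hc : ContDiffAt ℝ 2 c t) :
    deriv (F ∘ c) t = fderiv ℝ F (c t) (deriv c t) ∧
    deriv (deriv (F ∘ c)) t
      = fderiv ℝ (fderiv ℝ F) (c t) (deriv c t) (deriv c t)
        + fderiv ℝ F (c t) (deriv (deriv c) t) := by
  have hF1 : ∀ᶠ y in 𝓝 (c t), DifferentiableAt ℝ F y :=
    (hF.eventually (by simp)).mono fun y hy => hy.differentiableAt (by norm_num)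
  have hc1 : ∀ᶠ s in 𝓝 t, DifferentiableAt ℝ c s :=
    (hc.eventually (by simp)).mono fun y hy => hy.differentiableAt (by norm_num)
  have h1 : ∀ᶠ s in 𝓝 t, deriv (F ∘ c) s = fderiv ℝ F (c s) (deriv c s) := by
    filter_upwards [hc1, hc.continuousAt.eventually hF1] with s hs1 hs2
    exact (hs2.hasFDerivAt.comp_hasDerivAt s hs1.hasDerivAt).deriv
  refine ⟨h1.self_of_nhds, ?_⟩
  rw [Filter.EventuallyEq.deriv_eq h1]
  have hdF : DifferentiableAt ℝ (fderiv ℝ F) (c t) :=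
    (hF.fderiv_right (m := 1) (by norm_num)).differentiableAt (by norm_num)
  have hdc : DifferentiableAt ℝ (deriv c) t := by
    have := (hc.fderiv_right (m := 1) (by norm_num)).differentiableAt (by norm_num)
    exact this.clm_apply (differentiableAt_const (1 : ℝ))
  exact ((hdF.hasFDerivAt.comp_hasDerivAt t hc1.self_of_nhds.hasDerivAt).clm_apply
    hdc.hasDerivAt).deriv

/-- The geodesic equation is covariant under a change of coordinates `Φ`. -/
theorem geodesicDefect_comp {G : E → E →L[ℝ] E →L[ℝ] ℝ} {G' : E' → E' →L[ℝ] E' →L[ℝ] ℝ}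
    {Φ : E → E'} {c : ℝ → E} {t : ℝ} (hΦ : ContDiffAt ℝ 2 Φ (c t)) (hc : ContDiffAt ℝ 2 c t)
    (hG : DifferentiableAt ℝ G (c t)) (hG' : DifferentiableAt ℝ G' (Φ (c t)))
    (hsymm : ∀ u v, G' (Φ (c t)) u v = G' (Φ (c t)) v u)
    (h : ∀ᶠ y in 𝓝 (c t), ∀ u v, G y u v = G' (Φ y) (fderiv ℝ Φ y u) (fderiv ℝ Φ y v)) (w : E) :
    geodesicDefect (fun z u v => G' z u v) ((Φ ∘ c) t) (deriv (Φ ∘ c) t) (deriv (deriv (Φ ∘ c)) t)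
        (fderiv ℝ Φ (c t) w)
      = geodesicDefect (fun z u v => G z u v) (c t) (deriv c t) (deriv (deriv c) t) w := by
  -- Leibniz rule for the pulled-back metric. Of the second-derivative terms of `Φ`, the one in the
  -- velocity twice joins the acceleration; the others cancel by symmetry of the Hessian and of
  -- `G'`.
  have hd : ∀ u v k, fderiv ℝ G (c t) k u v
      = fderiv ℝ G' (Φ (c t)) (fderiv ℝ Φ (c t) k) (fderiv ℝ Φ (c t) u) (fderiv ℝ Φ (c t) v)
        + G' (Φ (c t)) (fderiv ℝ (fderiv ℝ Φ) (c t) k u) (fderiv ℝ Φ (c t) v)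
        + G' (Φ (c t)) (fderiv ℝ Φ (c t) u) (fderiv ℝ (fderiv ℝ Φ) (c t) k v) := by
    intro u v k
    rw [← fderiv_bilin_apply hG, Filter.EventuallyEq.fderiv_eq (h.mono fun y hy => hy u v),
      hasFDerivAt_bilin_comp hG' (hΦ.differentiableAt (by norm_num)).hasFDerivAt
        (ContDiffAt.hasFDerivAt_fderiv_apply hΦ u) (ContDiffAt.hasFDerivAt_fderiv_apply hΦ v)]
    simp
  obtain ⟨e1, e2⟩ := deriv_deriv_comp hΦ hc
  rw [geodesicDefect_bilin hG, geodesicDefect_bilin (by exact hG'), hd, hd, h.self_of_nhds, e1, e2,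
    fderiv_fderiv_comm hΦ w (deriv c t),
    hsymm (fderiv ℝ (fderiv ℝ Φ) (c t) (deriv c t) w) (fderiv ℝ Φ (c t) (deriv c t))]
  simp only [Function.comp_apply, map_add, add_apply]
  ring

/-- Let `F` be a submersion, `a` a form that vanishes on the kernel of `dF`, `Q` a frame with
`a (Q X) = X` on which `da` vanishes, and let `G` be the metric on the target which pulls back
to `B (a, a)`. Then `F` maps the integral curves of the fields `Q X` to geodesics of `G`. -/
theorem geodesicDefect_frame {F : EP → E} {Q : EP → EK →L[ℝ] EP} {a : EP → EP →L[ℝ] EK}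
    {G : E → E →L[ℝ] E →L[ℝ] ℝ} {B : EK → EK → ℝ} {y : ℝ → EP} {t : ℝ}
    (hF : ContDiffAt ℝ 2 F (y t)) (hQ : DifferentiableAt ℝ Q (y t))
    (ha : DifferentiableAt ℝ a (y t)) (hsurj : Function.Surjective (fderiv ℝ F (y t)))
    (haQ : ∀ᶠ z in 𝓝 (y t), ∀ X, a z (Q z X) = X)
    (hker : ∀ v, a (y t) v = 0 → fderiv ℝ F (y t) v = 0)
    (hd : ∀ X Z, fderiv ℝ a (y t) (Q (y t) X) (Q (y t) Z)
      = fderiv ℝ a (y t) (Q (y t) Z) (Q (y t) X))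
    (hG : DifferentiableAt ℝ G (F (y t))) (hsymm : ∀ u v, G (F (y t)) u v = G (F (y t)) v u)
    (hB : ∀ᶠ z in 𝓝 (y t), ∀ u v, G (F z) (fderiv ℝ F z u) (fderiv ℝ F z v) = B (a z u) (a z v))
    {X : EK} (hy : ∀ᶠ s in 𝓝 t, HasDerivAt y (Q (y s) X) s) (w : E) :
    geodesicDefect (fun z u v => G z u v) ((F ∘ y) t) (deriv (F ∘ y) t) (deriv (deriv (F ∘ y)) t)
      w = 0 := by
  set y₀ := y t with hy₀
  have hF1 : DifferentiableAt ℝ F y₀ := hF.differentiableAt (by norm_num)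
  have hF1' : ∀ᶠ z in 𝓝 y₀, DifferentiableAt ℝ F z :=
    (hF.eventually (by simp)).mono fun y hy => hy.differentiableAt (by norm_num)
  have hdF : DifferentiableAt ℝ (fderiv ℝ F) y₀ :=
    (hF.fderiv_right (m := 1) (by norm_num)).differentiableAt (by norm_num)
  have hQX : ∀ X, HasFDerivAt (fun z => Q z X) ((fderiv ℝ Q y₀).flip X) y₀ := by
    intro X
    convert hQ.hasFDerivAt.clm_apply (hasFDerivAt_const X y₀) using 1
    ext; simp
  have hE : ∀ X, HasFDerivAt (fun z => fderiv ℝ F z (Q z X))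
      ((fderiv ℝ F y₀).comp ((fderiv ℝ Q y₀).flip X)
        + (fderiv ℝ (fderiv ℝ F) y₀).flip (Q y₀ X)) y₀ :=
    fun X => hdF.hasFDerivAt.clm_apply (hQX X)
  -- `S Z X` is the derivative along `Q Z` of the projected frame vector `dF (Q X)`.
  set S : EK → EK → E := fun Z X => fderiv ℝ F y₀ (fderiv ℝ Q y₀ (Q y₀ Z) X)
    + fderiv ℝ (fderiv ℝ F) y₀ (Q y₀ Z) (Q y₀ X) with hS
  -- Vanishing torsion: differentiating `a (Q X) = X` gives `a (D_{QZ} Q X) = -(D_{QZ} a)(Q X)`,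
  -- which is symmetric by `hd`. So the bracket of two frame fields lies in the kernel of `a`, hence
  -- of `dF`.
  have hSsymm : ∀ Z X, S Z X = S X Z := by
    intro Z X
    have h1 : ∀ Z X, a y₀ (fderiv ℝ Q y₀ (Q y₀ Z) X) = - fderiv ℝ a y₀ (Q y₀ Z) (Q y₀ X) := by
      intro Z X
      have e1 := (ha.hasFDerivAt.clm_apply (hQX X)).fderiv
      have e2 : fderiv ℝ (fun z => a z (Q z X)) y₀ = 0 := by
        rw [Filter.EventuallyEq.fderiv_eq (haQ.mono fun z hz => hz X)]
        simp
      rw [e2] at e1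
      have := congrArg (fun L => L (Q y₀ Z)) e1
      simp at this
      rw [eq_neg_iff_add_eq_zero]
      exact this.symm
    have h2 := hker (fderiv ℝ Q y₀ (Q y₀ Z) X - fderiv ℝ Q y₀ (Q y₀ X) Z) (by
      rw [map_sub, h1, h1, hd Z X, sub_self])
    rw [map_sub, sub_eq_zero] at h2
    simp only [hS, h2, fderiv_fderiv_comm hF (Q y₀ Z) (Q y₀ X)]
  -- Metric compatibility: the projected frame vectors have the constant inner products `B X X'`, so
  -- their derivative along `Q Z` is zero.
  have hmain : ∀ Z X X', fderiv ℝ G (F y₀) (fderiv ℝ F y₀ (Q y₀ Z)) (fderiv ℝ F y₀ (Q y₀ X))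
      (fderiv ℝ F y₀ (Q y₀ X')) + G (F y₀) (S Z X) (fderiv ℝ F y₀ (Q y₀ X'))
      + G (F y₀) (fderiv ℝ F y₀ (Q y₀ X)) (S Z X') = 0 := by
    intro Z X X'
    have e1 := hasFDerivAt_bilin_comp hG hF1.hasFDerivAt (hE X) (hE X') (Q y₀ Z)
    have e2 : fderiv ℝ (fun z => G (F z) (fderiv ℝ F z (Q z X)) (fderiv ℝ F z (Q z X'))) y₀ = 0 := by
      have : (fun z => G (F z) (fderiv ℝ F z (Q z X)) (fderiv ℝ F z (Q z X'))) =ᶠ[𝓝 y₀]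
          fun _ => B X X' := by
        filter_upwards [hB, haQ] with z h1 h2
        rw [h1, h2, h2]
      rw [this.fderiv_eq]
      simp
    rw [e2] at e1
    simpa [hS] using e1.symm
  obtain ⟨Z, rfl⟩ : ∃ Z, fderiv ℝ F y₀ (Q y₀ Z) = w := by
    obtain ⟨v, rfl⟩ := hsurj w
    refine ⟨a y₀ v, ?_⟩
    rw [← sub_eq_zero, ← map_sub]
    apply hker
    rw [map_sub, haQ.self_of_nhds, sub_self]
  have hyt : ContinuousAt y t := hy.self_of_nhds.continuousAt
  have h1 : deriv (F ∘ y) =ᶠ[𝓝 t] fun s => fderiv ℝ F (y s) (Q (y s) X) := by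
    filter_upwards [hy, hyt.eventually hF1'] with s hs1 hs2
    exact (hs2.hasFDerivAt.comp_hasDerivAt s hs1).deriv
  have h2 : deriv (deriv (F ∘ y)) t = S X X := by
    rw [h1.deriv_eq]
    refine ((hE X).comp_hasDerivAt t hy.self_of_nhds).deriv.trans ?_
    simp [hS, hy₀]
  rw [geodesicDefect_bilin (by simpa using hG), h1.self_of_nhds, h2]
  -- Koszul's argument: the acceleration is `S X X`, and these two identities, with `S` symmetric,
  -- cancel all terms of the geodesic equation.
  have m1 := hmain X X Z
  have m2 := hmain Z X X
  rw [hsymm (S Z X) _, hSsymm Z X] at m2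
  simp only [Function.comp_apply, ← hy₀]
  linarith

end Calculus

end PrincipalComplex

namespace PrincipalComplex

/-! ### The geodesic equation as an ordinary differential equation. -/

section GeodesicODE

open Filter Topology

variable {E : Type*} [NormedAddCommGroup E] [NormedSpace ℝ E]

/-- The Christoffel symbols `w ↦ Γ(u, u; w)` of the metric `G` at `z = (y, u)`. -/
noncomputable def christoffelCLM (G : E → E →L[ℝ] E →L[ℝ] ℝ) (z : E × E) : E →L[ℝ] ℝ :=
  fderiv ℝ G z.1 z.2 z.2 - (1 / 2 : ℝ) • ((fderiv ℝ G z.1).flip z.2).flip z.2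

set_option synthInstance.maxHeartbeats 200000 in
theorem contDiffAt_flip {Z E₁ E₂ F : Type*} [NormedAddCommGroup Z] [NormedSpace ℝ Z]
    [NormedAddCommGroup E₁] [NormedSpace ℝ E₁] [NormedAddCommGroup E₂] [NormedSpace ℝ E₂]
    [NormedAddCommGroup F] [NormedSpace ℝ F] {n : WithTop ℕ∞} {f : Z → E₁ →L[ℝ] E₂ →L[ℝ] F}
    {z : Z} (hf : ContDiffAt ℝ n f z) : ContDiffAt ℝ n (fun z => (f z).flip) z := by
  have h : ContDiff ℝ n (fun g : E₁ →L[ℝ] E₂ →L[ℝ] F => g.flip) :=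
    LinearIsometryEquiv.contDiff (𝕜 := ℝ) (E := E₁ →L[ℝ] E₂ →L[ℝ] F) (F := E₂ →L[ℝ] E₁ →L[ℝ] F)
      (ContinuousLinearMap.flipₗᵢ ℝ E₁ E₂ F)
  exact h.contDiffAt.comp (g := fun g : E₁ →L[ℝ] E₂ →L[ℝ] F => g.flip) z hf

theorem contDiffAt_fderiv_fst {F : Type*} [NormedAddCommGroup F] [NormedSpace ℝ F] {G : E → F}
    {z : E × E} (hG : ContDiffAt ℝ 2 G z.1) :
    ContDiffAt ℝ 1 (fun z : E × E => fderiv ℝ G z.1) z :=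
  ContDiffAt.comp (g := fderiv ℝ G) z (hG.fderiv_right (m := 1) (by norm_num)) contDiffAt_fst

theorem contDiffAt_christoffelCLM {G : E → E →L[ℝ] E →L[ℝ] ℝ} {z : E × E}
    (hG : ContDiffAt ℝ 2 G z.1) : ContDiffAt ℝ 1 (christoffelCLM G) z := by
  have h1 := contDiffAt_fderiv_fst (F := E →L[ℝ] E →L[ℝ] ℝ) hG
  have h2 : ContDiffAt ℝ 1 (fun z : E × E => z.2) z := contDiffAt_snd
  have h3 : ContDiffAt ℝ 1 (fun z : E × E => (fderiv ℝ G z.1).flip z.2) z :=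
    (contDiffAt_flip (F := E →L[ℝ] ℝ) h1).clm_apply h2
  have h4 : ContDiffAt ℝ 1 (fun z : E × E => ((fderiv ℝ G z.1).flip z.2).flip z.2) z :=
    (contDiffAt_flip (F := ℝ) h3).clm_apply h2
  have h5 : ContDiffAt ℝ 1 (fun z : E × E => fderiv ℝ G z.1 z.2) z :=
    ContDiffAt.clm_apply (F := E) (G := E →L[ℝ] E →L[ℝ] ℝ) h1 h2
  exact (h5.clm_apply h2).sub (h4.const_smul (1 / 2 : ℝ))

variable [FiniteDimensional ℝ E]

theorem isInvertible_of_pos {G : E →L[ℝ] E →L[ℝ] ℝ} (hpos : ∀ u, u ≠ 0 → 0 < G u u) :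
    G.IsInvertible := by
  have hinj : Function.Injective G := by
    rw [injective_iff_map_eq_zero]
    intro u hu
    by_contra h
    have := hpos u h
    simp [hu] at this
  have hdim : Module.finrank ℝ E = Module.finrank ℝ (E →L[ℝ] ℝ) := by
    rw [← (LinearMap.toContinuousLinearMap (𝕜 := ℝ) (E := E) (F' := ℝ)).finrank_eq]
    exact (Subspace.dual_finrank_eq).symm
  exact ⟨(LinearEquiv.ofInjectiveOfFinrankEq G.toLinearMap hinj hdim).toContinuousLinearEquiv,
    by ext; rfl⟩

theorem eventually_isInvertible {E₁ E₂ X : Type*} [NormedAddCommGroup E₁] [NormedSpace ℝ E₁]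
    [CompleteSpace E₁] [NormedAddCommGroup E₂] [NormedSpace ℝ E₂] [TopologicalSpace X]
    {f : X → E₁ →L[ℝ] E₂} {x : X} (hf : ContinuousAt f x) (h : (f x).IsInvertible) :
    ∀ᶠ y in 𝓝 x, (f y).IsInvertible := by
  obtain ⟨e, he⟩ := h
  exact hf.eventually (he ▸ e.nhds)

/-- Uniqueness for the geodesic equation. -/
theorem eventuallyEq_of_geodesicDefect {G : E → E →L[ℝ] E →L[ℝ] ℝ} {c₁ c₂ : ℝ → E} {t : ℝ}
    (hG : ContDiffAt ℝ 2 G (c₁ t)) (hpos : ∀ u, u ≠ 0 → 0 < G (c₁ t) u u)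
    (h₁ : ContDiffAt ℝ 2 c₁ t) (h₂ : ContDiffAt ℝ 2 c₂ t) (h0 : c₁ t = c₂ t)
    (h0' : deriv c₁ t = deriv c₂ t)
    (hg₁ : ∀ᶠ s in 𝓝 t, ∀ w,
      geodesicDefect (fun z u v => G z u v) (c₁ s) (deriv c₁ s) (deriv (deriv c₁) s) w = 0)
    (hg₂ : ∀ᶠ s in 𝓝 t, ∀ w,
      geodesicDefect (fun z u v => G z u v) (c₂ s) (deriv c₂ s) (deriv (deriv c₂) s) w = 0) :
    c₁ =ᶠ[𝓝 t] c₂ := by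
  have hinv := isInvertible_of_pos hpos
  -- The first-order system for position and velocity: inverting the metric solves for the
  -- acceleration. `V` is `C¹` at the initial point, hence locally Lipschitz.
  set V : E × E → E × E := fun z => (z.2, - (G z.1).inverse (christoffelCLM G z)) with hV
  have hVsmooth : ContDiffAt ℝ 1 V (c₁ t, deriv c₁ t) := by
    have e1 : ContDiffAt ℝ 1 (fun z : E × E => G z.1) (c₁ t, deriv c₁ t) :=
      ContDiffAt.comp (g := G) (c₁ t, deriv c₁ t) (hG.of_le (by norm_num)) contDiffAt_fst
    have e2 : ContDiffAt ℝ 1 (fun z : E × E => (G z.1).inverse) (c₁ t, deriv c₁ t) :=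
      ContDiffAt.comp (g := ContinuousLinearMap.inverse) (c₁ t, deriv c₁ t)
        hinv.contDiffAt_map_inverse e1
    exact contDiffAt_snd.prodMk (e2.clm_apply (contDiffAt_christoffelCLM hG)).neg
  obtain ⟨C, s, hs, hlip⟩ := hVsmooth.exists_lipschitzOnWith
  have key : ∀ c : ℝ → E, ContDiffAt ℝ 2 c t → c t = c₁ t → deriv c t = deriv c₁ t →
      (∀ᶠ s in 𝓝 t, ∀ w,
        geodesicDefect (fun z u v => G z u v) (c s) (deriv c s) (deriv (deriv c) s) w = 0) →
      ∀ᶠ τ in 𝓝 t, HasDerivAt (fun τ => (c τ, deriv c τ)) (V (c τ, deriv c τ)) τ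
        ∧ (c τ, deriv c τ) ∈ s := by
    intro c hc e e' hg
    have hc1 : ∀ᶠ s in 𝓝 t, ContDiffAt ℝ 2 c s := hc.eventually (by simp)
    have hdc : ContDiffAt ℝ 1 (deriv c) t :=
      (hc.fderiv_right (m := 1) (by norm_num)).clm_apply contDiffAt_const
    have hdc1 : ∀ᶠ s in 𝓝 t, ContDiffAt ℝ 1 (deriv c) s := hdc.eventually (by simp)
    have hcont : ContinuousAt (fun τ => (c τ, deriv c τ)) t :=
      hc.continuousAt.prodMk hdc.continuousAt
    have hGd : ∀ᶠ y in 𝓝 (c t), ContDiffAt ℝ 2 G y := by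
      rw [e]; exact hG.eventually (by simp)
    have hGi : ∀ᶠ y in 𝓝 (c t), (G y).IsInvertible := by
      rw [e]; exact eventually_isInvertible hG.continuousAt hinv
    filter_upwards [hg, hc1, hdc1, hcont.eventually_mem (by simpa only [e, e'] using hs),
      hc.continuousAt.eventually hGd, hc.continuousAt.eventually hGi] with τ a1 a2 a3 a4 a5 a6
    refine ⟨?_, a4⟩
    have b1 : deriv (deriv c) τ = - (G (c τ)).inverse (christoffelCLM G (c τ, deriv c τ)) := by
      obtain ⟨e, he⟩ := a6
      rw [← he, ContinuousLinearMap.inverse_equiv]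
      have : G (c τ) (deriv (deriv c) τ) = - christoffelCLM G (c τ, deriv c τ) := by
        ext w
        have := a1 w
        rw [geodesicDefect_bilin (a5.differentiableAt (by norm_num))] at this
        simp [christoffelCLM]
        linarith
      rw [← he] at this
      rw [← map_neg, ← this]
      simp
    have b2 := (a2.differentiableAt (by norm_num)).hasDerivAt.prodMk
      (a3.differentiableAt (by norm_num)).hasDerivAt
    rw [b1] at b2
    exact b2
  have := ODE_solution_unique_of_eventually (v := fun _ => V) (s := fun _ => s)
    (Filter.Eventually.of_forall fun _ => hlip)
    (key c₁ h₁ rfl rfl hg₁) (key c₂ h₂ h0.symm h0'.symm hg₂) (by simp [h0, h0'])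
  exact this.mono fun τ hτ => congrArg Prod.fst hτ

end GeodesicODE

end PrincipalComplex

namespace PrincipalComplex

/-! ### Derivatives of charts, and vector fields in charts. -/

section Charts

open Filter Topology Set

variable {E : Type*} [NormedAddCommGroup E] [NormedSpace ℝ E]
  {N : Type*} [TopologicalSpace N] [ChartedSpace E N] [IsManifold 𝓘(ℝ, E) ∞ N]

theorem contMDiffAt_extChartAt_of_mem {x₀ x : N} (hx : x ∈ (extChartAt 𝓘(ℝ, E) x₀).source) :
    ContMDiffAt 𝓘(ℝ, E) 𝓘(ℝ, E) ∞ (extChartAt 𝓘(ℝ, E) x₀) x :=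
  contMDiffAt_extChartAt' (by simpa using hx)

theorem contMDiffAt_extChartAt_symm_of_mem {x₀ : N} {y : E}
    (hy : y ∈ (extChartAt 𝓘(ℝ, E) x₀).target) :
    ContMDiffAt 𝓘(ℝ, E) 𝓘(ℝ, E) ∞ (extChartAt 𝓘(ℝ, E) x₀).symm y :=
  (contMDiffOn_extChartAt_symm x₀).contMDiffAt ((isOpen_extChartAt_target x₀).mem_nhds hy)

/-- The equality is taken in the model space because the two base points agree only propositionally.
-/
theorem mfderiv_extChartAt_symm_comp {x₀ x : N} (hx : x ∈ (extChartAt 𝓘(ℝ, E) x₀).source)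
    (v : TangentSpace 𝓘(ℝ, E) x) :
    (mfderiv 𝓘(ℝ, E) 𝓘(ℝ, E) (extChartAt 𝓘(ℝ, E) x₀).symm (extChartAt 𝓘(ℝ, E) x₀ x)
      (mfderiv 𝓘(ℝ, E) 𝓘(ℝ, E) (extChartAt 𝓘(ℝ, E) x₀) x v) : E) = (v : E) := by
  have h1 := (contMDiffAt_extChartAt_of_mem hx).mdifferentiableAt (by simp)
  have h2 := (contMDiffAt_extChartAt_symm_of_mem
    ((extChartAt 𝓘(ℝ, E) x₀).map_source hx)).mdifferentiableAt (by simp)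
  have h3 := mfderiv_comp x h2 h1
  have h4 : (extChartAt 𝓘(ℝ, E) x₀).symm ∘ (extChartAt 𝓘(ℝ, E) x₀) =ᶠ[𝓝 x] id := by
    filter_upwards [(isOpen_extChartAt_source x₀).mem_nhds hx] with z hz
    exact (extChartAt 𝓘(ℝ, E) x₀).left_inv hz
  rw [h4.mfderiv_eq, mfderiv_id] at h3
  exact (congrArg (fun L => (L v : E)) h3).symm

theorem mfderiv_extChartAt_comp_symm {x₀ : N} {y : E}
    (hy : y ∈ (extChartAt 𝓘(ℝ, E) x₀).target) (v : E) :
    (mfderiv 𝓘(ℝ, E) 𝓘(ℝ, E) (extChartAt 𝓘(ℝ, E) x₀) ((extChartAt 𝓘(ℝ, E) x₀).symm y)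
      (mfderiv 𝓘(ℝ, E) 𝓘(ℝ, E) (extChartAt 𝓘(ℝ, E) x₀).symm y v) : E) = v := by
  have h1 := (contMDiffAt_extChartAt_of_mem
    ((extChartAt 𝓘(ℝ, E) x₀).map_target hy)).mdifferentiableAt (by simp)
  have h2 := (contMDiffAt_extChartAt_symm_of_mem hy).mdifferentiableAt (by simp)
  have h3 := mfderiv_comp y h1 h2
  have h4 : (extChartAt 𝓘(ℝ, E) x₀) ∘ (extChartAt 𝓘(ℝ, E) x₀).symm =ᶠ[𝓝 y] id := by
    filter_upwards [(isOpen_extChartAt_target x₀).mem_nhds hy] with z hz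
    exact (extChartAt 𝓘(ℝ, E) x₀).right_inv hz
  rw [h4.mfderiv_eq, mfderiv_id] at h3
  exact (congrArg (fun L => (L v : E)) h3).symm

/-- A vector field is smooth at `x₀` if it is so in the chart at `x₀`. -/
theorem contMDiffAt_vectorField {V : ∀ x : N, TangentSpace 𝓘(ℝ, E) x} {x₀ : N} {W : E → E}
    (hW : ContDiffAt ℝ ∞ W (extChartAt 𝓘(ℝ, E) x₀ x₀))
    (h : ∀ᶠ x in 𝓝 x₀, (mfderiv 𝓘(ℝ, E) 𝓘(ℝ, E) (extChartAt 𝓘(ℝ, E) x₀) x (V x) : E)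
      = W (extChartAt 𝓘(ℝ, E) x₀ x)) :
    ContMDiffAt 𝓘(ℝ, E) 𝓘(ℝ, E).tangent ∞ (fun x => (⟨x, V x⟩ : TangentBundle 𝓘(ℝ, E) N)) x₀ := by
  refine (Bundle.contMDiffAt_section (F := E) (E := (TangentSpace 𝓘(ℝ, E) : N → Type _)) x₀).2 ?_
  have h1 : ContMDiffAt 𝓘(ℝ, E) 𝓘(ℝ, E) ∞ (W ∘ extChartAt 𝓘(ℝ, E) x₀) x₀ :=
    hW.contMDiffAt.comp x₀ (contMDiffAt_extChartAt_of_mem (mem_extChartAt_source x₀))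
  refine h1.congr_of_eventuallyEq ?_
  filter_upwards [h, (isOpen_extChartAt_source (I := 𝓘(ℝ, E)) x₀).mem_nhds
    (mem_extChartAt_source x₀)] with x hx hx'
  have hx'' : x ∈ (chartAt E x₀).source := by simpa using hx'
  have e1 := congrArg (fun L => L (V x))
    (TangentBundle.continuousLinearMapAt_trivializationAt (I := 𝓘(ℝ, E)) hx'')
  refine Eq.trans ?_ (e1.trans hx)
  refine Eq.symm ?_
  refine (congrFun (Bundle.Trivialization.continuousLinearMapAt_apply ℝ
    (trivializationAt E (TangentSpace 𝓘(ℝ, E)) x₀) x) (V x)).trans ?_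
  exact congrFun (Bundle.Trivialization.coe_linearMapAt_of_mem _ (by simpa using hx'')) (V x)

end Charts

/-! ### Lie algebra valued forms in charts. -/

section Forms

open Filter Topology Set

variable {EK EP : Type*}
  [NormedAddCommGroup EK] [NormedSpace ℝ EK]
  [NormedAddCommGroup EP] [NormedSpace ℝ EP] [FiniteDimensional ℝ EP]
  {K P : Type*} [TopologicalSpace K] [ChartedSpace EK K] [Group K]
  [TopologicalSpace P] [ChartedSpace EP P] [IsManifold 𝓘(ℝ, EP) ∞ P]

/-- In finite dimensions it suffices to evaluate at a fixed vector. The result is the smooth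
function `β` on `TP` composed with the tangent map of the inverse chart and a constant section. -/
theorem contDiffOn_inChart (β : LieForm EK EP K P) (p₀ : P) :
    ContDiffOn ℝ ∞ (inChart β p₀) (extChartAt 𝓘(ℝ, EP) p₀).target := by
  rw [contDiffOn_clm_apply]
  intro v
  have ho := isOpen_extChartAt_target (I := 𝓘(ℝ, EP)) p₀
  have h1 : ContMDiffOn 𝓘(ℝ, EP).tangent 𝓘(ℝ, EP).tangent ∞
      (tangentMapWithin 𝓘(ℝ, EP) 𝓘(ℝ, EP) (extChartAt 𝓘(ℝ, EP) p₀).symm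
        (extChartAt 𝓘(ℝ, EP) p₀).target) _ :=
    (contMDiffOn_extChartAt_symm (n := ∞) p₀).contMDiffOn_tangentMapWithin (m := ∞) (by simp)
      ho.uniqueMDiffOn
  have h2 : ContMDiff 𝓘(ℝ, EP) 𝓘(ℝ, EP).tangent ∞
      (fun y : EP => (⟨y, v⟩ : TangentBundle 𝓘(ℝ, EP) EP)) := by
    intro y
    refine contMDiffAt_vectorField (V := fun _ => v) (W := fun _ => v) contDiffAt_const ?_
    filter_upwards with x
    have e : (extChartAt 𝓘(ℝ, EP) y : EP → EP) = id := by
      rw [extChartAt_model_space_eq_id, PartialEquiv.refl_coe]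
    have e' : (mfderiv 𝓘(ℝ, EP) 𝓘(ℝ, EP) (id : EP → EP) x v : EP) = v :=
      congrArg (fun L : EP →L[ℝ] EP => L v) (mfderiv_id (I := 𝓘(ℝ, EP)) (x := x))
    rw [e]
    exact e'
  have h3 := β.smooth.comp_contMDiffOn (h1.comp
    (h2.contMDiffOn (s := (extChartAt 𝓘(ℝ, EP) p₀).target)) (fun y hy => hy))
  refine h3.contDiffOn.congr fun y hy => ?_
  have e := mfderivWithin_of_isOpen (I := 𝓘(ℝ, EP)) (I' := 𝓘(ℝ, EP))
    (f := (extChartAt 𝓘(ℝ, EP) p₀).symm) ho hy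
  exact (congrArg (fun L => β.toFun ((extChartAt 𝓘(ℝ, EP) p₀).symm y) (L v)) e).symm

theorem contDiffAt_inChart (β : LieForm EK EP K P) {p₀ : P} {y : EP}
    (hy : y ∈ (extChartAt 𝓘(ℝ, EP) p₀).target) : ContDiffAt ℝ ∞ (inChart β p₀) y :=
  (contDiffOn_inChart β p₀).contDiffAt ((isOpen_extChartAt_target p₀).mem_nhds hy)

omit [FiniteDimensional ℝ EP] in
theorem inChart_apply (β : LieForm EK EP K P) {p₀ p : P}
    (hp : p ∈ (extChartAt 𝓘(ℝ, EP) p₀).source) (v : TangentSpace 𝓘(ℝ, EP) p) :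
    inChart β p₀ (extChartAt 𝓘(ℝ, EP) p₀ p)
      (mfderiv 𝓘(ℝ, EP) 𝓘(ℝ, EP) (extChartAt 𝓘(ℝ, EP) p₀) p v) = β.toFun p v := by
  have h1 := mfderiv_extChartAt_symm_comp hp v
  have h2 := (extChartAt 𝓘(ℝ, EP) p₀).left_inv hp
  have h3 : ∀ q : P, q = p → ∀ w : EP, w = v → (β.toFun q w : EK) = β.toFun p v := by
    rintro q rfl w rfl
    rfl
  exact h3 _ h2 _ h1

end Forms

end PrincipalComplex

namespace PrincipalComplex

/-! ### The standard horizontal vector fields. -/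

section Frame

open Filter Topology Set

set_option linter.unusedSectionVars false

variable {EK EM EP : Type*}
  [NormedAddCommGroup EK] [NormedSpace ℝ EK]
  [NormedAddCommGroup EM] [NormedSpace ℝ EM]
  [NormedAddCommGroup EP] [NormedSpace ℝ EP]
  {K M P : Type*} [TopologicalSpace K] [ChartedSpace EK K] [Group K]
  [TopologicalSpace M] [ChartedSpace EM M]
  [TopologicalSpace P] [ChartedSpace EP P] [IsManifold 𝓘(ℝ, EP) ∞ P]
  [MulAction Kᵐᵒᵖ P] {pr : P → M} {θ α : LieForm EK EP K P}

theorem theta_alphaInv (hiso : ∀ p, Function.Bijective (restrictHorizontal θ α p)) (p : P)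
    (X : GroupLieAlgebra 𝓘(ℝ, EK) K) : θ.toFun p (alphaInv θ α hiso p X) = 0 :=
  ((LinearEquiv.ofBijective (restrictHorizontal θ α p) (hiso p)).symm X).2

theorem alpha_alphaInv (hiso : ∀ p, Function.Bijective (restrictHorizontal θ α p)) (p : P)
    (X : GroupLieAlgebra 𝓘(ℝ, EK) K) : α.toFun p (alphaInv θ α hiso p X) = X :=
  (LinearEquiv.ofBijective (restrictHorizontal θ α p) (hiso p)).apply_symm_apply X

theorem eq_zero_of_forms (hiso : ∀ p, Function.Bijective (restrictHorizontal θ α p)) {p : P}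
    {v : TangentSpace 𝓘(ℝ, EP) p} (h1 : θ.toFun p v = 0) (h2 : α.toFun p v = 0) : v = 0 := by
  have h3 : (⟨v, h1⟩ : horizontal θ p) = 0 :=
    (hiso p).1 ((show restrictHorizontal θ α p ⟨v, h1⟩ = 0 from h2).trans (map_zero _).symm)
  exact congrArg Subtype.val h3

theorem eq_alphaInv (hiso : ∀ p, Function.Bijective (restrictHorizontal θ α p)) {p : P}
    {v : TangentSpace 𝓘(ℝ, EP) p} {X : GroupLieAlgebra 𝓘(ℝ, EK) K} (h1 : θ.toFun p v = 0)
    (h2 : α.toFun p v = X) : v = alphaInv θ α hiso p X := by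
  rw [← sub_eq_zero]
  refine eq_zero_of_forms hiso ?_ ?_
  · rw [map_sub, h1, theta_alphaInv, sub_zero]
  · rw [map_sub, h2, alpha_alphaInv, sub_self]

theorem mdifferentiableAt_action [IsManifold 𝓘(ℝ, EK) ∞ K]
    (hpr : IsPrincipalBundle EK EM EP K pr) (p : P) (k : K) :
    MDifferentiableAt 𝓘(ℝ, EK) 𝓘(ℝ, EP) (fun k : K => p <• k) k := by
  have h : ContMDiff 𝓘(ℝ, EK) 𝓘(ℝ, EP) ∞ (fun k : K => p <• k) :=
    hpr.smooth_action.comp (contMDiff_const.prodMk contMDiff_id)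
  exact h.mdifferentiable (by simp) k

theorem mdifferentiableAt_rightAction (hpr : IsPrincipalBundle EK EM EP K pr) (k : K) (p : P) :
    MDifferentiableAt 𝓘(ℝ, EP) 𝓘(ℝ, EP) (fun q : P => q <• k) p := by
  have h : ContMDiff 𝓘(ℝ, EP) 𝓘(ℝ, EP) ∞ (fun q : P => q <• k) :=
    hpr.smooth_action.comp (contMDiff_id.prodMk contMDiff_const)
  exact h.mdifferentiable (by simp) p

variable [IsManifold 𝓘(ℝ, EK) ∞ K]

theorem mfderiv_pr_fundamental (hpr : IsPrincipalBundle EK EM EP K pr) (p : P)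
    (X : GroupLieAlgebra 𝓘(ℝ, EK) K) :
    mfderiv 𝓘(ℝ, EP) 𝓘(ℝ, EM) pr p (fundamental p X) = 0 := by
  have h1 : MDifferentiableAt 𝓘(ℝ, EP) 𝓘(ℝ, EM) pr (p <• (1 : K)) :=
    hpr.smooth_proj.mdifferentiable (by simp) _
  have h2 := h1.hasMFDerivAt.comp (1 : K) (mdifferentiableAt_action hpr p 1).hasMFDerivAt
  have h3 : pr ∘ (fun k : K => p <• k) = fun _ => pr p := by
    ext k
    exact hpr.proj_action p k
  rw [h3] at h2
  have h4 := (hasMFDerivAt_unique h2 (hasMFDerivAt_const (I := 𝓘(ℝ, EK)) (pr p) (1 : K)))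
  have h5 : ∀ q : P, q = p → (mfderiv 𝓘(ℝ, EP) 𝓘(ℝ, EM) pr q
      (show EP from fundamental p X) : EM) = 0 →
      (mfderiv 𝓘(ℝ, EP) 𝓘(ℝ, EM) pr p (fundamental p X) : EM) = 0 := by
    rintro q rfl h
    exact h
  exact h5 _ (by simp) (congrArg (fun L : EK →L[ℝ] EM => L X) h4)

theorem alpha_fundamental (hpr : IsPrincipalBundle EK EM EP K pr) (hα : α.IsTensorial EM pr)
    (p : P) (X : GroupLieAlgebra 𝓘(ℝ, EK) K) : α.toFun p (fundamental p X) = 0 :=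
  hα.vertical p _ (mfderiv_pr_fundamental hpr p X)

/-- `α⁻¹ ∘ α` is the horizontal projection, because `α` kills vertical vectors. -/
theorem alphaInv_alpha (hpr : IsPrincipalBundle EK EM EP K pr) (hθ : θ.IsConnection)
    (hα : α.IsTensorial EM pr) (hiso : ∀ p, Function.Bijective (restrictHorizontal θ α p)) {p : P}
    (v : TangentSpace 𝓘(ℝ, EP) p) :
    alphaInv θ α hiso p (α.toFun p v) = v - fundamental p (θ.toFun p v) := by
  symm
  apply eq_alphaInv
  · rw [map_sub, hθ.fundamental, sub_self]
  · rw [map_sub, alpha_fundamental hpr hα, sub_zero]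

theorem mfderiv_pr_alphaInv (hpr : IsPrincipalBundle EK EM EP K pr) (hθ : θ.IsConnection)
    (hα : α.IsTensorial EM pr) (hiso : ∀ p, Function.Bijective (restrictHorizontal θ α p)) {p : P}
    (v : TangentSpace 𝓘(ℝ, EP) p) :
    mfderiv 𝓘(ℝ, EP) 𝓘(ℝ, EM) pr p (alphaInv θ α hiso p (α.toFun p v))
      = mfderiv 𝓘(ℝ, EP) 𝓘(ℝ, EM) pr p v := by
  rw [alphaInv_alpha hpr hθ hα, map_sub, mfderiv_pr_fundamental hpr, sub_zero]

/-- Converse of `IsTensorial.vertical`: the kernel of `α` is exactly the vertical space. -/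
theorem mfderiv_pr_eq_zero (hpr : IsPrincipalBundle EK EM EP K pr) (hθ : θ.IsConnection)
    (hα : α.IsTensorial EM pr) (hiso : ∀ p, Function.Bijective (restrictHorizontal θ α p)) {p : P}
    {v : TangentSpace 𝓘(ℝ, EP) p} (hv : α.toFun p v = 0) :
    mfderiv 𝓘(ℝ, EP) 𝓘(ℝ, EM) pr p v = 0 := by
  rw [← mfderiv_pr_alphaInv hpr hθ hα hiso, hv, map_zero, map_zero]

theorem exists_forms_eq (hpr : IsPrincipalBundle EK EM EP K pr) (hθ : θ.IsConnection)
    (hα : α.IsTensorial EM pr) (hiso : ∀ p, Function.Bijective (restrictHorizontal θ α p)) (p : P)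
    (X Y : GroupLieAlgebra 𝓘(ℝ, EK) K) :
    ∃ v : TangentSpace 𝓘(ℝ, EP) p, α.toFun p v = X ∧ θ.toFun p v = Y := by
  refine ⟨alphaInv θ α hiso p X + fundamental p Y, ?_, ?_⟩
  · rw [map_add, alpha_alphaInv, alpha_fundamental hpr hα, add_zero]
  · rw [map_add, theta_alphaInv, hθ.fundamental, zero_add]

/-- The frame `X ↦ α⁻¹ X` of the horizontal bundle in the chart at `p₀`. -/
noncomputable def chartFrame (θ α : LieForm EK EP K P) (p₀ : P) (y : EP) : EK →L[ℝ] EP :=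
  ((inChart α p₀ y).prod (inChart θ p₀ y)).inverse.comp (ContinuousLinearMap.inl ℝ EK EK)

variable [FiniteDimensional ℝ EP] [FiniteDimensional ℝ EK]

/-- Together `α` and `θ` form an absolute parallelism `TP ≅ 𝔨 × 𝔨`. Smoothness of the horizontal
frame then follows from smoothness of operator inversion. -/
theorem isInvertible_forms (hpr : IsPrincipalBundle EK EM EP K pr)
    (hθ : θ.IsConnection)
    (hα : α.IsTensorial EM pr) (hiso : ∀ p, Function.Bijective (restrictHorizontal θ α p))
    {p₀ p : P} (hp : p ∈ (extChartAt 𝓘(ℝ, EP) p₀).source) :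
    ((inChart α p₀ (extChartAt 𝓘(ℝ, EP) p₀ p)).prod
      (inChart θ p₀ (extChartAt 𝓘(ℝ, EP) p₀ p))).IsInvertible := by
  have hinj : Function.Injective ((inChart α p₀ (extChartAt 𝓘(ℝ, EP) p₀ p)).prod
      (inChart θ p₀ (extChartAt 𝓘(ℝ, EP) p₀ p))) := by
    rw [injective_iff_map_eq_zero]
    intro v hv
    have hv1 := congrArg Prod.fst hv
    have hv2 := congrArg Prod.snd hv
    have h1 := eq_zero_of_forms hiso hv2 hv1
    have h2 := mfderiv_extChartAt_comp_symm ((extChartAt 𝓘(ℝ, EP) p₀).map_source hp) v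
    exact h2.symm.trans ((congrArg (fun w => (mfderiv 𝓘(ℝ, EP) 𝓘(ℝ, EP) (extChartAt 𝓘(ℝ, EP) p₀)
      ((extChartAt 𝓘(ℝ, EP) p₀).symm (extChartAt 𝓘(ℝ, EP) p₀ p)) w : EP)) h1).trans (map_zero _))
  have hsurj : Function.Surjective ((inChart α p₀ (extChartAt 𝓘(ℝ, EP) p₀ p)).prod
      (inChart θ p₀ (extChartAt 𝓘(ℝ, EP) p₀ p))) := by
    rintro ⟨X, Y⟩
    obtain ⟨v, h1, h2⟩ := exists_forms_eq hpr hθ hα hiso p X Y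
    exact ⟨mfderiv 𝓘(ℝ, EP) 𝓘(ℝ, EP) (extChartAt 𝓘(ℝ, EP) p₀) p v,
      Prod.ext ((inChart_apply α hp v).trans h1) ((inChart_apply θ hp v).trans h2)⟩
  exact ⟨(LinearEquiv.ofBijective (ContinuousLinearMap.toLinearMap _)
    ⟨hinj, hsurj⟩).toContinuousLinearEquiv, by ext <;> rfl⟩

theorem contDiffAt_chartFrame (hpr : IsPrincipalBundle EK EM EP K pr) (hθ : θ.IsConnection)
    (hα : α.IsTensorial EM pr) (hiso : ∀ p, Function.Bijective (restrictHorizontal θ α p))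
    {p₀ p : P} (hp : p ∈ (extChartAt 𝓘(ℝ, EP) p₀).source) :
    ContDiffAt ℝ ∞ (chartFrame θ α p₀) (extChartAt 𝓘(ℝ, EP) p₀ p) := by
  have hy := (extChartAt 𝓘(ℝ, EP) p₀).map_source hp
  have h1 : ContDiffAt ℝ ∞ (fun y => (inChart α p₀ y).prod (inChart θ p₀ y))
      (extChartAt 𝓘(ℝ, EP) p₀ p) := by
    have e : ContDiff ℝ ∞ (ContinuousLinearMap.prodₗᵢ ℝ : (EP →L[ℝ] EK) × (EP →L[ℝ] EK) ≃ₗᵢ[ℝ] _) :=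
      LinearIsometryEquiv.contDiff (𝕜 := ℝ) _
    exact e.contDiffAt.comp _ ((contDiffAt_inChart α hy).prodMk (contDiffAt_inChart θ hy))
  have h2 := (isInvertible_forms hpr hθ hα hiso hp).contDiffAt_map_inverse (n := ∞)
  exact (ContDiffAt.comp (g := ContinuousLinearMap.inverse) (extChartAt 𝓘(ℝ, EP) p₀ p) h2 h1).clm_comp contDiffAt_const

theorem chartFrame_apply (hpr : IsPrincipalBundle EK EM EP K pr) (hθ : θ.IsConnection)
    (hα : α.IsTensorial EM pr) (hiso : ∀ p, Function.Bijective (restrictHorizontal θ α p))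
    {p₀ p : P} (hp : p ∈ (extChartAt 𝓘(ℝ, EP) p₀).source) (X : EK) :
    chartFrame θ α p₀ (extChartAt 𝓘(ℝ, EP) p₀ p) X
      = mfderiv 𝓘(ℝ, EP) 𝓘(ℝ, EP) (extChartAt 𝓘(ℝ, EP) p₀) p (alphaInv θ α hiso p X) := by
  obtain ⟨e, he⟩ := isInvertible_forms hpr hθ hα hiso hp
  have h1 : e (mfderiv 𝓘(ℝ, EP) 𝓘(ℝ, EP) (extChartAt 𝓘(ℝ, EP) p₀) p (alphaInv θ α hiso p X))
      = (X, 0) := by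
    have h2 := congrArg (fun L : EP →L[ℝ] EK × EK => L (mfderiv 𝓘(ℝ, EP) 𝓘(ℝ, EP)
      (extChartAt 𝓘(ℝ, EP) p₀) p (alphaInv θ α hiso p X))) he
    refine h2.trans (Prod.ext ((inChart_apply α hp _).trans (alpha_alphaInv hiso p X))
      ((inChart_apply θ hp _).trans (theta_alphaInv hiso p X)))
  rw [chartFrame, ← he, ContinuousLinearMap.inverse_equiv]
  exact (e.symm_apply_eq).2 h1.symm

theorem contMDiff_alphaInv (hpr : IsPrincipalBundle EK EM EP K pr) (hθ : θ.IsConnection)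
    (hα : α.IsTensorial EM pr) (hiso : ∀ p, Function.Bijective (restrictHorizontal θ α p))
    (X : GroupLieAlgebra 𝓘(ℝ, EK) K) :
    ContMDiff 𝓘(ℝ, EP) 𝓘(ℝ, EP).tangent ∞
      (fun p => (⟨p, alphaInv θ α hiso p X⟩ : TangentBundle 𝓘(ℝ, EP) P)) := by
  intro p₀
  refine contMDiffAt_vectorField (W := fun y => chartFrame θ α p₀ y X)
    ((contDiffAt_chartFrame hpr hθ hα hiso (mem_extChartAt_source p₀)).clm_apply
      contDiffAt_const) ?_
  filter_upwards [(isOpen_extChartAt_source (I := 𝓘(ℝ, EP)) p₀).mem_nhds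
    (mem_extChartAt_source p₀)] with p hp
  exact (chartFrame_apply hpr hθ hα hiso hp X).symm

end Frame

end PrincipalComplex

namespace PrincipalComplex

/-! ### Smoothness of the induced metric, and the projection in charts. -/

section Metric

open Filter Topology Set

set_option linter.unusedSectionVars false

/-- The coefficients of `g` in every chart are smooth, symmetric and positive definite. -/
def IsSmoothMetric {EM M : Type*} [NormedAddCommGroup EM] [NormedSpace ℝ EM] [TopologicalSpace M]
    [ChartedSpace EM M] (g : ∀ x : M, TangentSpace 𝓘(ℝ, EM) x → TangentSpace 𝓘(ℝ, EM) x → ℝ) :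
    Prop :=
  ∀ x₀ : M, ∀ y ∈ (extChartAt 𝓘(ℝ, EM) x₀).target, ∃ G : EM → EM →L[ℝ] EM →L[ℝ] ℝ,
    ContDiffAt ℝ 2 G y ∧ (∀ᶠ z in 𝓝 y, ∀ u v, metricInChart g x₀ z u v = G z u v) ∧
    (∀ u v, G y u v = G y v u) ∧ ∀ u, u ≠ 0 → 0 < G y u u

/-- The pullback of a bilinear form by a smooth family of linear maps. -/
theorem contDiffAt_pullback_bilin {Z E F : Type*} [NormedAddCommGroup Z] [NormedSpace ℝ Z]
    [NormedAddCommGroup E] [NormedSpace ℝ E] [NormedAddCommGroup F] [NormedSpace ℝ F]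
    {n : WithTop ℕ∞} {β : Z → E →L[ℝ] F} {z : Z} (B : F →L[ℝ] F →L[ℝ] ℝ)
    (hβ : ContDiffAt ℝ n β z) :
    ContDiffAt ℝ n (fun z => (((B.comp (β z)).flip.comp (β z)).flip : E →L[ℝ] E →L[ℝ] ℝ)) z := by
  have h1 : ContDiffAt ℝ n (fun z => B.comp (β z)) z :=
    ContDiffAt.clm_comp (F := F) (G := F →L[ℝ] ℝ) contDiffAt_const hβ
  have h2 : ContDiffAt ℝ n (fun z => (B.comp (β z)).flip) z := contDiffAt_flip (F := ℝ) h1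
  have h3 : ContDiffAt ℝ n (fun z => (B.comp (β z)).flip.comp (β z)) z :=
    ContDiffAt.clm_comp (F := F) (G := E →L[ℝ] ℝ) h2 hβ
  exact contDiffAt_flip (F := ℝ) h3

variable {EK EM EP : Type*}
  [NormedAddCommGroup EK] [NormedSpace ℝ EK]
  [NormedAddCommGroup EM] [NormedSpace ℝ EM]
  [NormedAddCommGroup EP] [NormedSpace ℝ EP]
  {K M P : Type*} [TopologicalSpace K] [ChartedSpace EK K] [Group K]
  [TopologicalSpace M] [ChartedSpace EM M] [IsManifold 𝓘(ℝ, EM) ∞ M]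
  [TopologicalSpace P] [ChartedSpace EP P] [IsManifold 𝓘(ℝ, EP) ∞ P]
  [MulAction Kᵐᵒᵖ P] {pr : P → M} {θ α : LieForm EK EP K P}

/-- The projection `pr` in the charts at `p₀` and `x₀`. -/
noncomputable def projInChart (EP EM : Type*) [NormedAddCommGroup EM] [NormedSpace ℝ EM]
    [NormedAddCommGroup EP] [NormedSpace ℝ EP] {M P : Type*}
    [TopologicalSpace M] [ChartedSpace EM M] [TopologicalSpace P] [ChartedSpace EP P]
    (pr : P → M) (x₀ : M) (p₀ : P) (y : EP) : EM :=
  extChartAt 𝓘(ℝ, EM) x₀ (pr ((extChartAt 𝓘(ℝ, EP) p₀).symm y))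

theorem contDiffAt_projInChart (hpr : IsPrincipalBundle EK EM EP K pr) {x₀ : M} {p₀ p : P}
    (hp : p ∈ (extChartAt 𝓘(ℝ, EP) p₀).source) (hx : pr p ∈ (extChartAt 𝓘(ℝ, EM) x₀).source) :
    ContDiffAt ℝ ∞ (projInChart EP EM pr x₀ p₀) (extChartAt 𝓘(ℝ, EP) p₀ p) := by
  have h1 := contMDiffAt_extChartAt_symm_of_mem ((extChartAt 𝓘(ℝ, EP) p₀).map_source hp)
  have e := (extChartAt 𝓘(ℝ, EP) p₀).left_inv hp
  have h2 : ContMDiffAt 𝓘(ℝ, EM) 𝓘(ℝ, EM) ∞ (extChartAt 𝓘(ℝ, EM) x₀)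
      (pr ((extChartAt 𝓘(ℝ, EP) p₀).symm (extChartAt 𝓘(ℝ, EP) p₀ p))) := by
    rw [e]
    exact contMDiffAt_extChartAt_of_mem hx
  exact (h2.comp (extChartAt 𝓘(ℝ, EP) p₀ p)
    (hpr.smooth_proj.contMDiffAt.comp (extChartAt 𝓘(ℝ, EP) p₀ p) h1)).contDiffAt

theorem fderiv_projInChart (hpr : IsPrincipalBundle EK EM EP K pr) {x₀ : M} {p₀ p : P}
    (hp : p ∈ (extChartAt 𝓘(ℝ, EP) p₀).source) (hx : pr p ∈ (extChartAt 𝓘(ℝ, EM) x₀).source)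
    (v : TangentSpace 𝓘(ℝ, EP) p) :
    fderiv ℝ (projInChart EP EM pr x₀ p₀) (extChartAt 𝓘(ℝ, EP) p₀ p)
      (mfderiv 𝓘(ℝ, EP) 𝓘(ℝ, EP) (extChartAt 𝓘(ℝ, EP) p₀) p v)
      = mfderiv 𝓘(ℝ, EM) 𝓘(ℝ, EM) (extChartAt 𝓘(ℝ, EM) x₀) (pr p)
          (mfderiv 𝓘(ℝ, EP) 𝓘(ℝ, EM) pr p v) := by
  have h1 : HasMFDerivAt 𝓘(ℝ, EP) 𝓘(ℝ, EM) (projInChart EP EM pr x₀ p₀)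
      (extChartAt 𝓘(ℝ, EP) p₀ p) _ :=
    ((contDiffAt_projInChart hpr hp hx).differentiableAt (by simp)).hasFDerivAt.hasMFDerivAt
  have h2 := h1.comp p
    ((contMDiffAt_extChartAt_of_mem hp).mdifferentiableAt (by simp)).hasMFDerivAt
  have h3 := HasMFDerivAt.comp p
    ((contMDiffAt_extChartAt_of_mem hx).mdifferentiableAt (by simp)).hasMFDerivAt
    ((hpr.smooth_proj.mdifferentiable (by simp) p).hasMFDerivAt)
  have h4 : projInChart EP EM pr x₀ p₀ ∘ extChartAt 𝓘(ℝ, EP) p₀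
      =ᶠ[𝓝 p] extChartAt 𝓘(ℝ, EM) x₀ ∘ pr := by
    filter_upwards [(isOpen_extChartAt_source (I := 𝓘(ℝ, EP)) p₀).mem_nhds hp] with q hq
    simp only [Function.comp_apply, projInChart, (extChartAt 𝓘(ℝ, EP) p₀).left_inv hq]
  have h5 := hasMFDerivAt_unique h2 (h3.congr_of_eventuallyEq h4)
  exact congrArg (fun L : EP →L[ℝ] EM => L v) h5

theorem projInChart_apply {x₀ : M} {p₀ p : P} (hp : p ∈ (extChartAt 𝓘(ℝ, EP) p₀).source) :
    projInChart EP EM pr x₀ p₀ (extChartAt 𝓘(ℝ, EP) p₀ p) = extChartAt 𝓘(ℝ, EM) x₀ (pr p) := by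
  simp only [projInChart, (extChartAt 𝓘(ℝ, EP) p₀).left_inv hp]

/-- Vectors in the chart at `p₀` come from tangent vectors. -/
theorem exists_mfderiv_extChartAt_eq {E N : Type*} [NormedAddCommGroup E] [NormedSpace ℝ E]
    [TopologicalSpace N] [ChartedSpace E N] [IsManifold 𝓘(ℝ, E) ∞ N] {p₀ p : N}
    (hp : p ∈ (extChartAt 𝓘(ℝ, E) p₀).source)
    (w : E) : ∃ v : TangentSpace 𝓘(ℝ, E) p,
      (mfderiv 𝓘(ℝ, E) 𝓘(ℝ, E) (extChartAt 𝓘(ℝ, E) p₀) p v : E) = w := by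
  have h := mfderiv_extChartAt_comp_symm ((extChartAt 𝓘(ℝ, E) p₀).map_source hp) w
  rw [(extChartAt 𝓘(ℝ, E) p₀).left_inv hp] at h
  exact ⟨_, h⟩

theorem surjective_fderiv_projInChart (hpr : IsPrincipalBundle EK EM EP K pr) {x₀ : M} {p₀ p : P}
    (hp : p ∈ (extChartAt 𝓘(ℝ, EP) p₀).source) (hx : pr p ∈ (extChartAt 𝓘(ℝ, EM) x₀).source) :
    Function.Surjective
      (fderiv ℝ (projInChart EP EM pr x₀ p₀) (extChartAt 𝓘(ℝ, EP) p₀ p)) := by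
  intro w
  obtain ⟨u, rfl⟩ := exists_mfderiv_extChartAt_eq hx w
  obtain ⟨v, rfl⟩ := hpr.mfderiv_surjective p u
  exact ⟨_, fderiv_projInChart hpr hp hx v⟩

variable [IsManifold 𝓘(ℝ, EK) ∞ K]

theorem fderiv_projInChart_eq_zero (hpr : IsPrincipalBundle EK EM EP K pr) (hθ : θ.IsConnection)
    (hα : α.IsTensorial EM pr) (hiso : ∀ p, Function.Bijective (restrictHorizontal θ α p))
    {x₀ : M} {p₀ p : P}
    (hp : p ∈ (extChartAt 𝓘(ℝ, EP) p₀).source) (hx : pr p ∈ (extChartAt 𝓘(ℝ, EM) x₀).source)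
    {w : EP} (hw : inChart α p₀ (extChartAt 𝓘(ℝ, EP) p₀ p) w = 0) :
    fderiv ℝ (projInChart EP EM pr x₀ p₀) (extChartAt 𝓘(ℝ, EP) p₀ p) w = 0 := by
  obtain ⟨v, rfl⟩ := exists_mfderiv_extChartAt_eq hp w
  have h1 : α.toFun p v = 0 := (inChart_apply α hp v).symm.trans hw
  refine (fderiv_projInChart hpr hp hx v).trans ?_
  rw [mfderiv_pr_eq_zero hpr hθ hα hiso h1]
  exact map_zero _

omit [IsManifold 𝓘(ℝ, EK) ∞ K] in
theorem inducedMetric_apply_of_eq (hpr : IsPrincipalBundle EK EM EP K pr)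
    (hα : α.IsTensorial EM pr) (B : AdInner EK K) {p : P} {x : M} (hx : x = pr p)
    (u v : TangentSpace 𝓘(ℝ, EP) p) {u' v' : EM}
    (hu : u' = (mfderiv 𝓘(ℝ, EP) 𝓘(ℝ, EM) pr p u : EM))
    (hv : v' = (mfderiv 𝓘(ℝ, EP) 𝓘(ℝ, EM) pr p v : EM)) :
    inducedMetric hpr α B x u' v' = B.form (α.toFun p u) (α.toFun p v) := by
  subst hx hu hv
  exact inducedMetric_apply hpr hα B p u v

theorem metricInChart_inducedMetric (hpr : IsPrincipalBundle EK EM EP K pr)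
    (hα : α.IsTensorial EM pr) (B : AdInner EK K) {x₀ : M} {p₀ p : P}
    (hp : p ∈ (extChartAt 𝓘(ℝ, EP) p₀).source) (hx : pr p ∈ (extChartAt 𝓘(ℝ, EM) x₀).source)
    (u v : EP) :
    metricInChart (inducedMetric hpr α B) x₀
      (projInChart EP EM pr x₀ p₀ (extChartAt 𝓘(ℝ, EP) p₀ p))
      (fderiv ℝ (projInChart EP EM pr x₀ p₀) (extChartAt 𝓘(ℝ, EP) p₀ p) u)
      (fderiv ℝ (projInChart EP EM pr x₀ p₀) (extChartAt 𝓘(ℝ, EP) p₀ p) v)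
      = B.form (inChart α p₀ (extChartAt 𝓘(ℝ, EP) p₀ p) u)
          (inChart α p₀ (extChartAt 𝓘(ℝ, EP) p₀ p) v) := by
  obtain ⟨u, rfl⟩ := exists_mfderiv_extChartAt_eq hp u
  obtain ⟨v, rfl⟩ := exists_mfderiv_extChartAt_eq hp v
  rw [fderiv_projInChart hpr hp hx, fderiv_projInChart hpr hp hx, projInChart_apply hp]
  refine (inducedMetric_apply_of_eq hpr hα B ((extChartAt 𝓘(ℝ, EM) x₀).left_inv hx) u v
    (mfderiv_extChartAt_symm_comp hx _) (mfderiv_extChartAt_symm_comp hx _)).trans ?_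
  rw [← inChart_apply α hp, ← inChart_apply α hp]

variable [FiniteDimensional ℝ EP] [FiniteDimensional ℝ EK]

/-- The inner product on the Lie algebra as a continuous bilinear form. -/
noncomputable def AdInner.toCLM (B : AdInner EK K) : EK →L[ℝ] EK →L[ℝ] ℝ :=
  LinearMap.toContinuousBilinearMap (E := EK) (F := EK) (G := ℝ) (𝕜 := ℝ) B.form

/-- Along a local section of `P` the metric is the inner product pulled back by `α` composed with
the derivative of the section. It is definite since the kernel of `α` is vertical, while the section
is transverse to the fibres. -/
theorem isSmoothMetric_inducedMetric (hpr : IsPrincipalBundle EK EM EP K pr)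
    (hθ : θ.IsConnection) (hα : α.IsTensorial EM pr)
    (hiso : ∀ p, Function.Bijective (restrictHorizontal θ α p)) (B : AdInner EK K) :
    IsSmoothMetric (inducedMetric hpr α B) := by
  intro x₀ y hy
  obtain ⟨e, hx, -, hsymm, -⟩ := hpr.locally_trivial ((extChartAt 𝓘(ℝ, EM) x₀).symm y)
  have hψ := contMDiffAt_extChartAt_symm_of_mem hy
  -- The local section with constant group component `1`, precomposed with the inverse chart of `M`.
  set h : EM → P := fun z => e.toOpenPartialHomeomorph.symm
    ((extChartAt 𝓘(ℝ, EM) x₀).symm z, (1 : K)) with hh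
  have hmem : ((extChartAt 𝓘(ℝ, EM) x₀).symm y, (1 : K)) ∈ e.target := e.mem_target.2 hx
  have hsm : ContMDiffAt 𝓘(ℝ, EM) 𝓘(ℝ, EP) ∞ h y := by
    have h1 : ContMDiffAt (𝓘(ℝ, EM).prod 𝓘(ℝ, EK)) 𝓘(ℝ, EP) ∞ e.toOpenPartialHomeomorph.symm
        ((extChartAt 𝓘(ℝ, EM) x₀).symm y, (1 : K)) :=
      (hsymm _ hmem).contMDiffAt (e.open_target.mem_nhds hmem)
    have h2 : ContMDiffAt 𝓘(ℝ, EM) (𝓘(ℝ, EM).prod 𝓘(ℝ, EK)) ∞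
        (fun z : EM => ((extChartAt 𝓘(ℝ, EM) x₀).symm z, (1 : K))) y :=
      hψ.prodMk contMDiffAt_const
    exact h1.comp y h2
  set k : EM → EP := fun z => extChartAt 𝓘(ℝ, EP) (h y) (h z) with hk
  have hksm : ContDiffAt ℝ ∞ k y :=
    ((contMDiffAt_extChartAt_of_mem (mem_extChartAt_source (I := 𝓘(ℝ, EP)) (h y))).comp y
      hsm).contDiffAt
  have hgood : ∀ᶠ z in 𝓝 y, h z ∈ (extChartAt 𝓘(ℝ, EP) (h y)).source ∧
      pr (h z) = (extChartAt 𝓘(ℝ, EM) x₀).symm z ∧ z ∈ (extChartAt 𝓘(ℝ, EM) x₀).target := by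
    filter_upwards [hsm.continuousAt.eventually_mem ((isOpen_extChartAt_source
      (I := 𝓘(ℝ, EP)) (h y)).mem_nhds (mem_extChartAt_source (h y))),
      hψ.continuousAt.eventually_mem (e.open_baseSet.mem_nhds hx),
      (isOpen_extChartAt_target (I := 𝓘(ℝ, EM)) x₀).mem_nhds hy] with z h1 h2 h3
    exact ⟨h1, e.proj_symm_apply' h2, h3⟩
  have hFk : ∀ᶠ z in 𝓝 y, projInChart EP EM pr x₀ (h y) (k z) = z := by
    filter_upwards [hgood] with z ⟨h1, h2, h3⟩
    rw [hk, projInChart_apply h1, h2, (extChartAt 𝓘(ℝ, EM) x₀).right_inv h3]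
  have hmem' : ∀ z, pr (h z) = (extChartAt 𝓘(ℝ, EM) x₀).symm z →
      z ∈ (extChartAt 𝓘(ℝ, EM) x₀).target → pr (h z) ∈ (extChartAt 𝓘(ℝ, EM) x₀).source := by
    intro z h2 h3
    rw [h2]
    exact (extChartAt 𝓘(ℝ, EM) x₀).map_target h3
  have hDFk : ∀ᶠ z in 𝓝 y, ∀ u, fderiv ℝ (projInChart EP EM pr x₀ (h y)) (k z)
      (fderiv ℝ k z u) = u := by
    filter_upwards [hFk.eventually_nhds, hgood,
      (hksm.of_le (m := 1) (by norm_cast)).eventually (by simp)] with z h1 ⟨h2, h3, h4⟩ h5 u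
    have e1 : HasFDerivAt (projInChart EP EM pr x₀ (h y) ∘ k) _ z :=
      HasFDerivAt.comp z
        ((contDiffAt_projInChart hpr h2 (hmem' z h3 h4)).differentiableAt (by simp)).hasFDerivAt
        (h5.differentiableAt one_ne_zero).hasFDerivAt
    have e2 : HasFDerivAt (projInChart EP EM pr x₀ (h y) ∘ k) (ContinuousLinearMap.id ℝ EM) z :=
      (hasFDerivAt_id z).congr_of_eventuallyEq h1
    exact congrArg (fun L : EM →L[ℝ] EM => L u) (e1.unique e2)
  have hker : ∀ᶠ z in 𝓝 y, ∀ u, inChart α (h y) (k z) (fderiv ℝ k z u) = 0 → u = 0 := by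
    filter_upwards [hDFk, hgood] with z h1 ⟨h2, h3, h4⟩ u h5
    rw [← h1 u]
    exact fderiv_projInChart_eq_zero hpr hθ hα hiso h2 (hmem' z h3 h4) h5
  have hβ : ContDiffAt ℝ 2 (fun z => (inChart α (h y) (k z)).comp (fderiv ℝ k z)) y := by
    have h1 : ContDiffAt ℝ ∞ (fun z => inChart α (h y) (k z)) y :=
      ContDiffAt.comp (g := inChart α (h y)) y (contDiffAt_inChart α
        ((extChartAt 𝓘(ℝ, EP) (h y)).map_source (mem_extChartAt_source (h y)))) hksm
    exact ((h1.of_le (by norm_cast)).clm_comp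
      (hksm.fderiv_right (m := 2) (by norm_cast)))
  refine ⟨_, contDiffAt_pullback_bilin B.toCLM hβ, ?_, ?_, ?_⟩
  · filter_upwards [hgood, hFk, hDFk] with z ⟨h1, h2, h3⟩ h4 h5 u v
    have h6 := metricInChart_inducedMetric hpr hα B h1 (hmem' z h2 h3) (fderiv ℝ k z u)
      (fderiv ℝ k z v)
    change metricInChart _ x₀ (projInChart EP EM pr x₀ (h y) (k z))
      (fderiv ℝ (projInChart EP EM pr x₀ (h y)) (k z) _)
      (fderiv ℝ (projInChart EP EM pr x₀ (h y)) (k z) _) = _ at h6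
    rw [h4, h5, h5] at h6
    exact h6
  · intro u v
    exact B.symm _ _
  · intro u hu
    exact B.pos _ fun h0 => hu (hker.self_of_nhds u h0)

end Metric

end PrincipalComplex

namespace PrincipalComplex

/-! ### Independence of the chart and uniqueness of geodesics. -/

section GeodesicUniqueness

open Filter Topology Set

set_option linter.unusedSectionVars false

variable {EM M : Type*} [NormedAddCommGroup EM] [NormedSpace ℝ EM]
  [TopologicalSpace M] [ChartedSpace EM M] [IsManifold 𝓘(ℝ, EM) ∞ M]
  {g : ∀ x : M, TangentSpace 𝓘(ℝ, EM) x → TangentSpace 𝓘(ℝ, EM) x → ℝ} {γ γ₁ γ₂ : ℝ → M}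
  {s : Set ℝ} {t : ℝ} {x₀ x₁ : M}

/-- The geodesic equation for `γ` at time `t` in the chart at `x₀`. -/
def GeodesicEqAt (g : ∀ x : M, TangentSpace 𝓘(ℝ, EM) x → TangentSpace 𝓘(ℝ, EM) x → ℝ)
    (γ : ℝ → M) (x₀ : M) (t : ℝ) : Prop :=
  ∀ w : EM, geodesicDefect (metricInChart g x₀) (extChartAt 𝓘(ℝ, EM) x₀ (γ t))
    (deriv (extChartAt 𝓘(ℝ, EM) x₀ ∘ γ) t) (deriv (deriv (extChartAt 𝓘(ℝ, EM) x₀ ∘ γ)) t) w = 0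

theorem contDiffAt_extChartAt_comp (hγ : ContMDiffAt 𝓘(ℝ, ℝ) 𝓘(ℝ, EM) ∞ γ t)
    (hx₀ : γ t ∈ (extChartAt 𝓘(ℝ, EM) x₀).source) :
    ContDiffAt ℝ 2 (extChartAt 𝓘(ℝ, EM) x₀ ∘ γ) t :=
  (((contMDiffAt_extChartAt_of_mem hx₀).comp t hγ).contDiffAt).of_le (by norm_cast)

theorem metricInChart_chart_change {z : EM} (hz : z ∈ (extChartAt 𝓘(ℝ, EM) x₀).target)
    (hz' : (extChartAt 𝓘(ℝ, EM) x₀).symm z ∈ (extChartAt 𝓘(ℝ, EM) x₁).source) (u v : EM) :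
    metricInChart g x₀ z u v = metricInChart g x₁
      ((extChartAt 𝓘(ℝ, EM) x₁ ∘ (extChartAt 𝓘(ℝ, EM) x₀).symm) z)
      (fderiv ℝ (extChartAt 𝓘(ℝ, EM) x₁ ∘ (extChartAt 𝓘(ℝ, EM) x₀).symm) z u)
      (fderiv ℝ (extChartAt 𝓘(ℝ, EM) x₁ ∘ (extChartAt 𝓘(ℝ, EM) x₀).symm) z v) := by
  have h1 : ∀ u : EM, (fderiv ℝ (extChartAt 𝓘(ℝ, EM) x₁ ∘ (extChartAt 𝓘(ℝ, EM) x₀).symm) z u : EM)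
      = mfderiv 𝓘(ℝ, EM) 𝓘(ℝ, EM) (extChartAt 𝓘(ℝ, EM) x₁) ((extChartAt 𝓘(ℝ, EM) x₀).symm z)
        (mfderiv 𝓘(ℝ, EM) 𝓘(ℝ, EM) (extChartAt 𝓘(ℝ, EM) x₀).symm z u) := by
    intro u
    have e := mfderiv_comp z ((contMDiffAt_extChartAt_of_mem hz').mdifferentiableAt (by simp))
      ((contMDiffAt_extChartAt_symm_of_mem hz).mdifferentiableAt (by simp))
    rw [mfderiv_eq_fderiv] at e
    exact congrArg (fun L : EM →L[ℝ] EM => L u) e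
  have h2 : ∀ (x y : M) (_ : x = y) (u v u' v' : EM), u = u' → v = v' →
      g x u v = g y u' v' := by
    rintro x _ rfl u v _ _ rfl rfl
    rfl
  refine h2 _ _ ((extChartAt 𝓘(ℝ, EM) x₁).left_inv hz').symm _ _ _ _ ?_ ?_
  · rw [h1]
    exact (mfderiv_extChartAt_symm_comp hz' _).symm
  · rw [h1]
    exact (mfderiv_extChartAt_symm_comp hz' _).symm

/-- `IsGeodesicOn` tests the equation in a chart that moves with `γ t`, while uniqueness of
solutions needs one chart for a whole time interval. -/
theorem GeodesicEqAt.chart_change (hg : IsSmoothMetric g)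
    (hγ : ContMDiffAt 𝓘(ℝ, ℝ) 𝓘(ℝ, EM) ∞ γ t) (hx₀ : γ t ∈ (extChartAt 𝓘(ℝ, EM) x₀).source)
    (hx₁ : γ t ∈ (extChartAt 𝓘(ℝ, EM) x₁).source) (h : GeodesicEqAt g γ x₀ t) :
    GeodesicEqAt g γ x₁ t := by
  have hz := (extChartAt 𝓘(ℝ, EM) x₀).map_source hx₀
  have hz' : (extChartAt 𝓘(ℝ, EM) x₀).symm (extChartAt 𝓘(ℝ, EM) x₀ (γ t))
      ∈ (extChartAt 𝓘(ℝ, EM) x₁).source := by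
    rwa [(extChartAt 𝓘(ℝ, EM) x₀).left_inv hx₀]
  set Φ : EM → EM := extChartAt 𝓘(ℝ, EM) x₁ ∘ (extChartAt 𝓘(ℝ, EM) x₀).symm with hΦ
  have hΦt : Φ (extChartAt 𝓘(ℝ, EM) x₀ (γ t)) = extChartAt 𝓘(ℝ, EM) x₁ (γ t) := by
    simp only [hΦ, Function.comp_apply, (extChartAt 𝓘(ℝ, EM) x₀).left_inv hx₀]
  have hΦsm : ContDiffAt ℝ 2 Φ ((extChartAt 𝓘(ℝ, EM) x₀ ∘ γ) t) :=
    ((contMDiffAt_extChartAt_of_mem hz').comp _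
      (contMDiffAt_extChartAt_symm_of_mem hz)).contDiffAt.of_le (by norm_cast)
  have hcomp : Φ ∘ (extChartAt 𝓘(ℝ, EM) x₀ ∘ γ) =ᶠ[𝓝 t] extChartAt 𝓘(ℝ, EM) x₁ ∘ γ := by
    filter_upwards [hγ.continuousAt.eventually_mem
      ((isOpen_extChartAt_source (I := 𝓘(ℝ, EM)) x₀).mem_nhds hx₀)] with τ hτ
    simp only [hΦ, Function.comp_apply, (extChartAt 𝓘(ℝ, EM) x₀).left_inv hτ]
  obtain ⟨G₀, hG₀, hG₀g, -, -⟩ := hg x₀ _ hz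
  obtain ⟨G₁, hG₁, hG₁g, hsymm, -⟩ := hg x₁ _ ((extChartAt 𝓘(ℝ, EM) x₁).map_source hx₁)
  rw [← hΦt] at hG₁ hG₁g hsymm
  have hcov : ∀ᶠ z in 𝓝 (extChartAt 𝓘(ℝ, EM) x₀ (γ t)), ∀ u v,
      G₀ z u v = G₁ (Φ z) (fderiv ℝ Φ z u) (fderiv ℝ Φ z v) := by
    filter_upwards [hG₀g, (show ContinuousAt Φ (extChartAt 𝓘(ℝ, EM) x₀ (γ t)) from
      hΦsm.continuousAt).eventually hG₁g,
      (isOpen_extChartAt_target (I := 𝓘(ℝ, EM)) x₀).mem_nhds hz,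
      (contMDiffAt_extChartAt_symm_of_mem hz).continuousAt.eventually_mem
        ((isOpen_extChartAt_source (I := 𝓘(ℝ, EM)) x₁).mem_nhds hz')] with z h1 h2 h3 h4 u v
    rw [← h1, ← h2]
    exact metricInChart_chart_change h3 h4 u v
  intro w
  -- The derivative of the transition map is onto, so test vectors of this form suffice.
  obtain ⟨w, rfl⟩ : ∃ w', fderiv ℝ Φ (extChartAt 𝓘(ℝ, EM) x₀ (γ t)) w' = w := by
    obtain ⟨v, rfl⟩ := exists_mfderiv_extChartAt_eq hz' w
    obtain ⟨v', rfl⟩ : ∃ v', (mfderiv 𝓘(ℝ, EM) 𝓘(ℝ, EM) (extChartAt 𝓘(ℝ, EM) x₀).symm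
        (extChartAt 𝓘(ℝ, EM) x₀ (γ t)) v') = v := by
      have e := mfderiv_extChartAt_symm_comp ((extChartAt 𝓘(ℝ, EM) x₀).map_target hz) v
      rw [(extChartAt 𝓘(ℝ, EM) x₀).right_inv hz] at e
      exact ⟨_, e⟩
    have e := mfderiv_comp (extChartAt 𝓘(ℝ, EM) x₀ (γ t))
      ((contMDiffAt_extChartAt_of_mem hz').mdifferentiableAt (by simp))
      ((contMDiffAt_extChartAt_symm_of_mem hz).mdifferentiableAt (by simp))
    rw [mfderiv_eq_fderiv] at e
    exact ⟨v', congrArg (fun L : EM →L[ℝ] EM => L v') e⟩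
  have key := geodesicDefect_comp hΦsm (contDiffAt_extChartAt_comp hγ hx₀)
    (hG₀.differentiableAt (by norm_num)) (hG₁.differentiableAt (by norm_num)) hsymm hcov w
  rw [hcomp.deriv_eq, hcomp.deriv.deriv_eq] at key
  have h1 := h w
  rw [geodesicDefect_congr hG₀g] at h1
  rw [← hΦt, geodesicDefect_congr hG₁g]
  exact key.trans h1

theorem IsGeodesicOn.contMDiffAt (h : IsGeodesicOn g γ s) (hs : IsOpen s) (ht : t ∈ s) :
    ContMDiffAt 𝓘(ℝ, ℝ) 𝓘(ℝ, EM) ∞ γ t :=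
  h.1.contMDiffAt (hs.mem_nhds ht)

theorem IsGeodesicOn.geodesicEqAt (hg : IsSmoothMetric g) (h : IsGeodesicOn g γ s)
    (hs : IsOpen s) (ht : t ∈ s) (hx₀ : γ t ∈ (extChartAt 𝓘(ℝ, EM) x₀).source) :
    GeodesicEqAt g γ x₀ t :=
  GeodesicEqAt.chart_change hg (h.contMDiffAt hs ht) (mem_extChartAt_source (γ t)) hx₀ (h.2 t ht)

theorem isGeodesicOn_of_geodesicEqAt (h : ContMDiffOn 𝓘(ℝ, ℝ) 𝓘(ℝ, EM) ∞ γ s)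
    (h' : ∀ t ∈ s, GeodesicEqAt g γ (γ t) t) : IsGeodesicOn g γ s :=
  ⟨h, h'⟩

theorem IsGeodesicOn.mono {s' : Set ℝ} (h : IsGeodesicOn g γ s) (hs : s' ⊆ s) :
    IsGeodesicOn g γ s' :=
  ⟨h.1.mono hs, fun t ht => h.2 t (hs ht)⟩

variable [FiniteDimensional ℝ EM]

/-- Local uniqueness of geodesics. -/
theorem IsGeodesicOn.eventuallyEq (hg : IsSmoothMetric g) (h₁ : IsGeodesicOn g γ₁ s)
    (h₂ : IsGeodesicOn g γ₂ s) (hs : IsOpen s) (ht : t ∈ s) (h0 : γ₁ t = γ₂ t)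
    (hx₀ : γ₁ t ∈ (extChartAt 𝓘(ℝ, EM) x₀).source)
    (h0' : deriv (extChartAt 𝓘(ℝ, EM) x₀ ∘ γ₁) t = deriv (extChartAt 𝓘(ℝ, EM) x₀ ∘ γ₂) t) :
    γ₁ =ᶠ[𝓝 t] γ₂ := by
  obtain ⟨G, hG, hGg, -, hpos⟩ := hg x₀ _ ((extChartAt 𝓘(ℝ, EM) x₀).map_source hx₀)
  have hsrc : ∀ γ : ℝ → M, IsGeodesicOn g γ s → γ t = γ₁ t →
      ∀ᶠ τ in 𝓝 t, γ τ ∈ (extChartAt 𝓘(ℝ, EM) x₀).source := by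
    intro γ h e
    exact (h.contMDiffAt hs ht).continuousAt.eventually_mem
      ((isOpen_extChartAt_source (I := 𝓘(ℝ, EM)) x₀).mem_nhds (e ▸ hx₀))
  have key : ∀ γ : ℝ → M, IsGeodesicOn g γ s → γ t = γ₁ t → ∀ᶠ τ in 𝓝 t, ∀ w,
      geodesicDefect (fun z u v => G z u v) ((extChartAt 𝓘(ℝ, EM) x₀ ∘ γ) τ)
        (deriv (extChartAt 𝓘(ℝ, EM) x₀ ∘ γ) τ)
        (deriv (deriv (extChartAt 𝓘(ℝ, EM) x₀ ∘ γ)) τ) w = 0 := by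
    intro γ h e
    have hcont : ContinuousAt (extChartAt 𝓘(ℝ, EM) x₀ ∘ γ) t :=
      (contDiffAt_extChartAt_comp (h.contMDiffAt hs ht) (e ▸ hx₀)).continuousAt
    have hGg' : ∀ᶠ z in 𝓝 ((extChartAt 𝓘(ℝ, EM) x₀ ∘ γ) t),
        ∀ᶠ z in 𝓝 z, ∀ u v, metricInChart g x₀ z u v = G z u v := by
      rw [Function.comp_apply, e]
      exact hGg.eventually_nhds
    filter_upwards [hsrc γ h e, hs.mem_nhds ht, hcont.eventually hGg'] with τ h1 h2 h3 w
    rw [← geodesicDefect_congr h3]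
    exact h.geodesicEqAt hg hs h2 h1 w
  have hc := eventuallyEq_of_geodesicDefect hG hpos
    (contDiffAt_extChartAt_comp (h₁.contMDiffAt hs ht) hx₀)
    (contDiffAt_extChartAt_comp (h₂.contMDiffAt hs ht) (h0 ▸ hx₀))
    (by simp only [Function.comp_apply, h0]) h0' (key γ₁ h₁ rfl) (key γ₂ h₂ h0.symm)
  filter_upwards [hc, hsrc γ₁ h₁ rfl, hsrc γ₂ h₂ h0.symm] with τ h1 h2 h3
  exact (extChartAt 𝓘(ℝ, EM) x₀).injOn h2 h3 h1

/-- Two geodesics on an open interval that agree near a point agree. -/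
theorem IsGeodesicOn.eqOn [T2Space M] (hg : IsSmoothMetric g) (h₁ : IsGeodesicOn g γ₁ s)
    (h₂ : IsGeodesicOn g γ₂ s) (hs : IsOpen s) (hs' : IsPreconnected s) (ht : t ∈ s)
    (h : γ₁ =ᶠ[𝓝 t] γ₂) : EqOn γ₁ γ₂ s := by
  -- The times with equal germs form an open set. It is closed in `s`, since position and velocity
  -- agree at limit points by continuity and local uniqueness applies there.
  have hsub : s ⊆ {τ | γ₁ =ᶠ[𝓝 τ] γ₂} := by
    refine hs'.subset_of_closure_inter_subset ?_ ⟨t, ht, h⟩ ?_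
    · exact isOpen_iff_mem_nhds.2 fun τ hτ => hτ.eventually_nhds
    · rintro τ ⟨hτ, hτs⟩
      rw [mem_closure_iff_frequently] at hτ
      have h0 : γ₁ τ = γ₂ τ := by
        have := isClosed_diagonal.mem_of_frequently_of_tendsto
          (f := fun σ => (γ₁ σ, γ₂ σ)) (hτ.mono fun σ hσ => hσ.self_of_nhds)
          ((h₁.contMDiffAt hs hτs).continuousAt.prodMk (h₂.contMDiffAt hs hτs).continuousAt)
        exact this
      have hcd : ∀ γ : ℝ → M, IsGeodesicOn g γ s → γ τ = γ₁ τ →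
          ContinuousAt (deriv (extChartAt 𝓘(ℝ, EM) (γ₁ τ) ∘ γ)) τ := by
        intro γ hγ e
        have h3 := contDiffAt_extChartAt_comp (x₀ := γ₁ τ) (hγ.contMDiffAt hs hτs)
          (by rw [e]; exact mem_extChartAt_source _)
        exact ((h3.fderiv_right (m := 1) (by norm_num)).clm_apply contDiffAt_const).continuousAt
      refine h₁.eventuallyEq hg h₂ hs hτs h0 (mem_extChartAt_source _) ?_
      have := isClosed_diagonal.mem_of_frequently_of_tendsto
        (f := fun σ => (deriv (extChartAt 𝓘(ℝ, EM) (γ₁ τ) ∘ γ₁) σ,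
          deriv (extChartAt 𝓘(ℝ, EM) (γ₁ τ) ∘ γ₂) σ))
        (hτ.mono fun σ hσ => Filter.EventuallyEq.deriv_eq (hσ.fun_comp _))
        ((hcd γ₁ h₁ rfl).prodMk (hcd γ₂ h₂ h0.symm))
      exact this
  exact fun τ hτ => (hsub hτ).self_of_nhds

end GeodesicUniqueness

end PrincipalComplex

namespace PrincipalComplex

/-! ### Integral curves in charts and their smoothness. -/

section IntegralCurves

open Filter Topology Set

variable {E : Type*} [NormedAddCommGroup E] [NormedSpace ℝ E]
  {N : Type*} [TopologicalSpace N] [ChartedSpace E N] [IsManifold 𝓘(ℝ, E) ∞ N]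

/-- The expression of a smooth vector field in the chart at `x₀`. -/
theorem exists_vectorField_inChart {V : ∀ x : N, TangentSpace 𝓘(ℝ, E) x} {x₀ : N}
    (hV : ContMDiffAt 𝓘(ℝ, E) 𝓘(ℝ, E).tangent ∞
      (fun x => (⟨x, V x⟩ : TangentBundle 𝓘(ℝ, E) N)) x₀) :
    ∃ W : E → E, ContDiffAt ℝ ∞ W (extChartAt 𝓘(ℝ, E) x₀ x₀) ∧
      ∀ᶠ x in 𝓝 x₀, (mfderiv 𝓘(ℝ, E) 𝓘(ℝ, E) (extChartAt 𝓘(ℝ, E) x₀) x (V x) : E)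
        = W (extChartAt 𝓘(ℝ, E) x₀ x) := by
  have h1 := (Bundle.contMDiffAt_section (F := E)
    (E := (TangentSpace 𝓘(ℝ, E) : N → Type _)) x₀).1 hV
  refine ⟨fun y => (trivializationAt E (TangentSpace 𝓘(ℝ, E)) x₀
    ⟨(extChartAt 𝓘(ℝ, E) x₀).symm y, V ((extChartAt 𝓘(ℝ, E) x₀).symm y)⟩).2, ?_, ?_⟩
  · have h2 := contMDiffAt_extChartAt_symm_of_mem (mem_extChartAt_target (I := 𝓘(ℝ, E)) x₀)
    rw [← (extChartAt 𝓘(ℝ, E) x₀).left_inv (mem_extChartAt_source (I := 𝓘(ℝ, E)) x₀)] at h1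
    have h3 := h1.comp _ h2
    rw [(extChartAt 𝓘(ℝ, E) x₀).left_inv (mem_extChartAt_source (I := 𝓘(ℝ, E)) x₀)] at h3
    exact h3.contDiffAt
  · filter_upwards [(isOpen_extChartAt_source (I := 𝓘(ℝ, E)) x₀).mem_nhds
      (mem_extChartAt_source x₀)] with x hx'
    have hx'' : x ∈ (chartAt E x₀).source := by simpa using hx'
    rw [(extChartAt 𝓘(ℝ, E) x₀).left_inv hx']
    have e1 := congrArg (fun L => L (V x))
      (TangentBundle.continuousLinearMapAt_trivializationAt (I := 𝓘(ℝ, E)) hx'')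
    refine e1.symm.trans ((congrFun (Bundle.Trivialization.continuousLinearMapAt_apply ℝ
      (trivializationAt E (TangentSpace 𝓘(ℝ, E)) x₀) x) (V x)).trans ?_)
    exact congrFun (Bundle.Trivialization.coe_linearMapAt_of_mem _ (by simpa using hx'')) (V x)

theorem hasDerivAt_extChartAt_comp {c : ℝ → N} {t : ℝ} {x₀ : N} {v : TangentSpace 𝓘(ℝ, E) (c t)}
    (hc : HasMFDerivAt 𝓘(ℝ, ℝ) 𝓘(ℝ, E) c t ((1 : ℝ →L[ℝ] ℝ).smulRight v))
    (hx : c t ∈ (extChartAt 𝓘(ℝ, E) x₀).source) :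
    HasDerivAt (extChartAt 𝓘(ℝ, E) x₀ ∘ c)
      (mfderiv 𝓘(ℝ, E) 𝓘(ℝ, E) (extChartAt 𝓘(ℝ, E) x₀) (c t) v : E) t := by
  let L : E →L[ℝ] E := mfderiv 𝓘(ℝ, E) 𝓘(ℝ, E) (extChartAt 𝓘(ℝ, E) x₀) (c t)
  have h : HasFDerivAt (extChartAt 𝓘(ℝ, E) x₀ ∘ c)
      (L.comp ((1 : ℝ →L[ℝ] ℝ).smulRight (show E from v))) t :=
    (((contMDiffAt_extChartAt_of_mem hx).mdifferentiableAt
      (by simp)).hasMFDerivAt.comp t hc).hasFDerivAt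
  exact h.hasDerivAt.congr_deriv (congrArg L (one_smul ℝ (show E from v)))

/-- Solutions of a smooth autonomous differential equation are smooth. -/
theorem contDiffAt_of_hasDerivAt {W : E → E} {f : ℝ → E} {t : ℝ} (hW : ContDiffAt ℝ ∞ W (f t))
    (hf : ∀ᶠ τ in 𝓝 t, HasDerivAt f (W (f τ)) τ) : ContDiffAt ℝ ∞ f t := by
  rw [contDiffAt_infty]
  -- Bootstrapping: if `f` is `C^n`, so is its derivative `W ∘ f`, and then `f` is `C^(n+1)`.
  intro n
  induction n with
  | zero =>
    refine contDiffAt_zero.2 ?_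
    obtain ⟨u, hu, h⟩ := hf.exists_mem
    exact ⟨u, hu, fun τ hτ => (h τ hτ).continuousAt.continuousWithinAt⟩
  | succ n ih =>
    refine (contDiffAt_succ_iff_hasFDerivAt (n := n)).2
      ⟨fun τ => ContinuousLinearMap.toSpanSingleton ℝ (W (f τ)), ?_, ?_⟩
    · obtain ⟨u, hu, h⟩ := hf.exists_mem
      exact ⟨u, hu, fun τ hτ => (h τ hτ).hasFDerivAt⟩
    · have h1 : ContDiffAt ℝ n (fun τ => W (f τ)) t :=
        ContDiffAt.comp t (hW.of_le (by exact_mod_cast le_top)) ih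
      exact (ContinuousLinearMap.toSpanSingletonCLE (𝕜 := ℝ) (E := E)).contDiff.contDiffAt.comp t h1

theorem contMDiffAt_of_isMIntegralCurveAt {V : ∀ x : N, TangentSpace 𝓘(ℝ, E) x}
    (hV : ContMDiff 𝓘(ℝ, E) 𝓘(ℝ, E).tangent ∞ (fun x => (⟨x, V x⟩ : TangentBundle 𝓘(ℝ, E) N)))
    {c : ℝ → N} {t : ℝ} (hc : IsMIntegralCurveAt c V t) :
    ContMDiffAt 𝓘(ℝ, ℝ) 𝓘(ℝ, E) ∞ c t := by
  obtain ⟨W, hW, hVW⟩ := exists_vectorField_inChart (hV (c t))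
  have hsrc := hc.continuousAt.eventually_mem ((isOpen_extChartAt_source (I := 𝓘(ℝ, E))
    (c t)).mem_nhds (mem_extChartAt_source (c t)))
  have h1 : ContDiffAt ℝ ∞ (extChartAt 𝓘(ℝ, E) (c t) ∘ c) t := by
    refine contDiffAt_of_hasDerivAt hW ?_
    filter_upwards [hc, hsrc, hc.continuousAt.eventually hVW] with τ h1 h2 h3
    have h4 := hasDerivAt_extChartAt_comp h1 h2
    rw [h3] at h4
    exact h4
  have h2 := (contMDiffAt_extChartAt_symm_of_mem (mem_extChartAt_target (I := 𝓘(ℝ, E))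
    (c t))).comp t (g := (extChartAt 𝓘(ℝ, E) (c t)).symm) h1.contMDiffAt
  refine h2.congr_of_eventuallyEq ?_
  filter_upwards [hsrc] with τ hτ
  exact ((extChartAt 𝓘(ℝ, E) (c t)).left_inv hτ).symm

end IntegralCurves

/-! ### Standard horizontal curves project to geodesics. -/

section Projection

open Filter Topology Set

set_option linter.unusedSectionVars false

variable {EK EM EP : Type*}
  [NormedAddCommGroup EK] [NormedSpace ℝ EK] [FiniteDimensional ℝ EK]
  [NormedAddCommGroup EM] [NormedSpace ℝ EM]
  [NormedAddCommGroup EP] [NormedSpace ℝ EP] [FiniteDimensional ℝ EP]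
  {K M P : Type*} [TopologicalSpace K] [ChartedSpace EK K] [Group K] [IsManifold 𝓘(ℝ, EK) ∞ K]
  [TopologicalSpace M] [ChartedSpace EM M] [IsManifold 𝓘(ℝ, EM) ∞ M]
  [TopologicalSpace P] [ChartedSpace EP P] [IsManifold 𝓘(ℝ, EP) ∞ P]
  [MulAction Kᵐᵒᵖ P] {pr : P → M} {θ α : LieForm EK EP K P}

/-- The frame vectors are horizontal, so on them `d_A α` is `dα`. Only the centre of the chart is
treated, where `extDer` is computed in that very chart. -/
theorem fderiv_inChart_symm (hpr : IsPrincipalBundle EK EM EP K pr) (hθ : θ.IsConnection)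
    (hα : α.IsTensorial EM pr) (hiso : ∀ p, Function.Bijective (restrictHorizontal θ α p))
    (hd : ∀ (p : P) (u v : TangentSpace 𝓘(ℝ, EP) p), covExtDer θ α p u v = 0) (p : P)
    (X Z : EK) :
    fderiv ℝ (inChart α p) (extChartAt 𝓘(ℝ, EP) p p)
        (chartFrame θ α p (extChartAt 𝓘(ℝ, EP) p p) X)
        (chartFrame θ α p (extChartAt 𝓘(ℝ, EP) p p) Z)
      = fderiv ℝ (inChart α p) (extChartAt 𝓘(ℝ, EP) p p)
        (chartFrame θ α p (extChartAt 𝓘(ℝ, EP) p p) Z)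
        (chartFrame θ α p (extChartAt 𝓘(ℝ, EP) p p) X) := by
  have h1 : ∀ X : GroupLieAlgebra 𝓘(ℝ, EK) K,
      horProj θ p (alphaInv θ α hiso p X) = alphaInv θ α hiso p X := by
    intro X
    rw [horProj, theta_alphaInv, map_zero, sub_zero]
  have h2 : ∀ X Z : GroupLieAlgebra 𝓘(ℝ, EK) K,
      extDer α p (alphaInv θ α hiso p X) (alphaInv θ α hiso p Z) = 0 := by
    intro X Z
    have h3 := hd p (alphaInv θ α hiso p X) (alphaInv θ α hiso p Z)
    unfold covExtDer at h3
    rwa [h1, h1] at h3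
  rw [chartFrame_apply hpr hθ hα hiso (mem_extChartAt_source p) X,
    chartFrame_apply hpr hθ hα hiso (mem_extChartAt_source p) Z]
  exact sub_eq_zero.1 (h2 X Z)

/-- Integral curves of the standard horizontal vector fields project to geodesics. -/
theorem isGeodesicOn_proj (hpr : IsPrincipalBundle EK EM EP K pr) (hθ : θ.IsConnection)
    (hα : α.IsTensorial EM pr) (hiso : ∀ p, Function.Bijective (restrictHorizontal θ α p))
    (B : AdInner EK K)
    (hd : ∀ (p : P) (u v : TangentSpace 𝓘(ℝ, EP) p), covExtDer θ α p u v = 0)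
    {X : GroupLieAlgebra 𝓘(ℝ, EK) K} {c : ℝ → P} {s : Set ℝ} (hs : IsOpen s)
    (hc : IsMIntegralCurveOn c (fun p => alphaInv θ α hiso p X) s) :
    IsGeodesicOn (inducedMetric hpr α B) (pr ∘ c) s := by
  have hcs : ∀ t ∈ s, IsMIntegralCurveAt c (fun p => alphaInv θ α hiso p X) t :=
    fun t ht => hc.isMIntegralCurveAt (hs.mem_nhds ht)
  refine isGeodesicOn_of_geodesicEqAt (fun t ht => ?_) (fun t ht => ?_)
  · exact (hpr.smooth_proj.contMDiffAt.comp t (contMDiffAt_of_isMIntegralCurveAt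
      (contMDiff_alphaInv hpr hθ hα hiso X) (hcs t ht))).contMDiffWithinAt
  intro w
  have hp := mem_extChartAt_source (I := 𝓘(ℝ, EP)) (c t)
  have hx := mem_extChartAt_source (I := 𝓘(ℝ, EM)) (pr (c t))
  set F := projInChart EP EM pr (pr (c t)) (c t) with hF
  set y : ℝ → EP := extChartAt 𝓘(ℝ, EP) (c t) ∘ c with hy
  have hcont := (hcs t ht).continuousAt
  have hsrc : ∀ᶠ τ in 𝓝 t, c τ ∈ (extChartAt 𝓘(ℝ, EP) (c t)).source :=
    hcont.eventually_mem ((isOpen_extChartAt_source (I := 𝓘(ℝ, EP)) (c t)).mem_nhds hp)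
  have hFy : F ∘ y =ᶠ[𝓝 t] extChartAt 𝓘(ℝ, EM) ((pr ∘ c) t) ∘ (pr ∘ c) := by
    filter_upwards [hsrc] with τ hτ
    exact projInChart_apply hτ
  have hderiv : ∀ᶠ τ in 𝓝 t, HasDerivAt y (chartFrame θ α (c t) (y τ) X) τ := by
    filter_upwards [hcs t ht, hsrc] with τ h1 h2
    rw [hy, Function.comp_apply, chartFrame_apply hpr hθ hα hiso h2 X]
    exact hasDerivAt_extChartAt_comp h1 h2
  have hFt : F (y t) = extChartAt 𝓘(ℝ, EM) (pr (c t)) (pr (c t)) := projInChart_apply hp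
  obtain ⟨G, hG, hGg, hsymm, -⟩ := isSmoothMetric_inducedMetric hpr hθ hα hiso B (pr (c t)) _
    (mem_extChartAt_target (I := 𝓘(ℝ, EM)) (pr (c t)))
  have hFsm : ContDiffAt ℝ ∞ F (y t) := contDiffAt_projInChart hpr hp hx
  -- Coordinates near `y t` come from points of `P` at which both charts apply, so pointwise
  -- identities on `P` become local identities in the chart.
  have htgt : ∀ᶠ z in 𝓝 (y t), ∃ q ∈ (extChartAt 𝓘(ℝ, EP) (c t)).source,
      pr q ∈ (extChartAt 𝓘(ℝ, EM) (pr (c t))).source ∧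
      extChartAt 𝓘(ℝ, EP) (c t) q = z := by
    have hsymm_cont : ContinuousAt (fun z => pr ((extChartAt 𝓘(ℝ, EP) (c t)).symm z)) (y t) :=
      hpr.smooth_proj.continuous.continuousAt.comp (contMDiffAt_extChartAt_symm_of_mem
        (mem_extChartAt_target (I := 𝓘(ℝ, EP)) (c t))).continuousAt
    have e : pr ((extChartAt 𝓘(ℝ, EP) (c t)).symm (y t)) = pr (c t) := by
      rw [hy, Function.comp_apply, (extChartAt 𝓘(ℝ, EP) (c t)).left_inv hp]
    filter_upwards [(isOpen_extChartAt_target (I := 𝓘(ℝ, EP)) (c t)).mem_nhds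
      (mem_extChartAt_target (I := 𝓘(ℝ, EP)) (c t)), hsymm_cont.eventually_mem
      ((isOpen_extChartAt_source (I := 𝓘(ℝ, EM)) (pr (c t))).mem_nhds (by rw [e]; exact hx))]
      with z hz hz'
    exact ⟨_, (extChartAt 𝓘(ℝ, EP) (c t)).map_target hz, hz',
      (extChartAt 𝓘(ℝ, EP) (c t)).right_inv hz⟩
  have key := geodesicDefect_frame (F := F) (Q := chartFrame θ α (c t)) (a := inChart α (c t))
    (G := G) (B := fun u v => B.form u v) (y := y) (t := t) (X := X)
    (hFsm.of_le (by norm_cast))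
    ((contDiffAt_chartFrame hpr hθ hα hiso hp).differentiableAt (by simp))
    ((contDiffAt_inChart α (mem_extChartAt_target (c t))).differentiableAt (by simp))
    (surjective_fderiv_projInChart hpr hp hx) ?_ ?_
    (fderiv_inChart_symm hpr hθ hα hiso hd (c t))
    (by rw [hFt]; exact hG.differentiableAt (by norm_num)) (by rw [hFt]; exact hsymm) ?_ hderiv w
  · rw [hFy.deriv_eq, hFy.deriv.deriv_eq, hFy.self_of_nhds] at key
    exact (geodesicDefect_congr hGg _ _ _).trans key
  · filter_upwards [htgt] with z ⟨q, h1, h2, h3⟩ Z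
    rw [← h3, chartFrame_apply hpr hθ hα hiso h1]
    exact (inChart_apply α h1 _).trans (alpha_alphaInv hiso q Z)
  · exact fun v hv => fderiv_projInChart_eq_zero hpr hθ hα hiso hp hx hv
  · rw [← hFt] at hGg
    filter_upwards [htgt, hFsm.continuousAt.eventually hGg] with z ⟨q, h1, h2, h3⟩ h4 u v
    rw [← h4, ← h3]
    exact metricInChart_inducedMetric hpr hα B h1 h2 u v

end Projection

end PrincipalComplex

namespace PrincipalComplex

/-! ### Velocities of curves. -/

section Curves

open Filter Topology Set

variable {E E' : Type*} [NormedAddCommGroup E] [NormedSpace ℝ E]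
  [NormedAddCommGroup E'] [NormedSpace ℝ E']
  {N N' : Type*} [TopologicalSpace N] [ChartedSpace E N] [TopologicalSpace N'] [ChartedSpace E' N']

/-- `c` has velocity `v` at `t`. -/
def HasVelocityAt (E : Type*) [NormedAddCommGroup E] [NormedSpace ℝ E] {N : Type*}
    [TopologicalSpace N] [ChartedSpace E N] (c : ℝ → N) (v : E) (t : ℝ) : Prop :=
  HasMFDerivAt 𝓘(ℝ, ℝ) 𝓘(ℝ, E) c t ((1 : ℝ →L[ℝ] ℝ).smulRight v : ℝ →L[ℝ] E)

/-- The base point `x` is separate from `c t` to allow propositional equalities such as `k 0 = 1`.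
-/
theorem HasVelocityAt.comp {c : ℝ → N} {v : E} {t : ℝ} {f : N → N'} {L : E →L[ℝ] E'} {x : N}
    (hc : HasVelocityAt E c v t) (hx : x = c t) (hf : HasMFDerivAt 𝓘(ℝ, E) 𝓘(ℝ, E') f x L) :
    HasVelocityAt E' (fun τ => f (c τ)) (L v) t := by
  subst hx
  have h : HasMFDerivAt 𝓘(ℝ, ℝ) 𝓘(ℝ, E') (f ∘ c) t
    (L.comp ((1 : ℝ →L[ℝ] ℝ).smulRight v) : ℝ →L[ℝ] E') := HasMFDerivAt.comp t hf hc
  have e : L.comp ((1 : ℝ →L[ℝ] ℝ).smulRight v) = (1 : ℝ →L[ℝ] ℝ).smulRight (L v) := by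
    ext; simp
  rw [e] at h
  exact h

theorem HasVelocityAt.comp_hasDerivAt {c : ℝ → N} {v : E} {t : ℝ} {f : ℝ → ℝ} {a : ℝ} {x : ℝ}
    (hc : HasVelocityAt E c v x) (hx : x = f t) (hf : HasDerivAt f a t) :
    HasVelocityAt E (fun τ => c (f τ)) (a • v) t := by
  subst hx
  have h : HasMFDerivAt 𝓘(ℝ, ℝ) 𝓘(ℝ, E) (c ∘ f) t
    (((1 : ℝ →L[ℝ] ℝ).smulRight v).comp (ContinuousLinearMap.toSpanSingleton ℝ a) : ℝ →L[ℝ] E) :=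
    HasMFDerivAt.comp t hc hf.hasFDerivAt.hasMFDerivAt
  have e : ((1 : ℝ →L[ℝ] ℝ).smulRight v).comp (ContinuousLinearMap.toSpanSingleton ℝ a)
      = (1 : ℝ →L[ℝ] ℝ).smulRight (a • v) := by
    ext; simp
  rw [e] at h
  exact h

theorem HasVelocityAt.unique {c : ℝ → N} {v w : E} {t : ℝ} (hv : HasVelocityAt E c v t)
    (hw : HasVelocityAt E c w t) : v = w := by
  have h := congrArg (fun L : ℝ →L[ℝ] E => L 1) (hasMFDerivAt_unique hv hw)
  simpa using h

theorem HasVelocityAt.congr {c c' : ℝ → N} {v : E} {t : ℝ} (hv : HasVelocityAt E c v t)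
    (h : c' =ᶠ[𝓝 t] c) : HasVelocityAt E c' v t :=
  HasMFDerivAt.congr_of_eventuallyEq hv h

theorem isMIntegralCurveOn_of_hasVelocityAt {c : ℝ → N} {V : ∀ x : N, TangentSpace 𝓘(ℝ, E) x}
    {s : Set ℝ} (h : ∀ t ∈ s, HasVelocityAt E c (V (c t)) t) : IsMIntegralCurveOn c V s :=
  fun t ht => (h t ht).hasMFDerivWithinAt

theorem hasVelocityAt_of_isMIntegralCurveOn {c : ℝ → N} {V : ∀ x : N, TangentSpace 𝓘(ℝ, E) x}
    {s : Set ℝ} {t : ℝ} (h : IsMIntegralCurveOn c V s) (hs : IsOpen s) (ht : t ∈ s) :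
    HasVelocityAt E c (V (c t)) t :=
  (h t ht).hasMFDerivAt (hs.mem_nhds ht)

end Curves

/-! ### Continuation of integral curves. -/

section Gluing

open Filter Topology Set

variable {E : Type*} [NormedAddCommGroup E] [NormedSpace ℝ E]
  {N : Type*} [TopologicalSpace N] [ChartedSpace E N] [IsManifold 𝓘(ℝ, E) 1 N] [T2Space N]

/-- If near every time `b` all integral curves starting at `p` can be continued past `b`, then
there is a global integral curve starting at `p`. -/
theorem exists_isMIntegralCurve_of_extension {V : ∀ x : N, TangentSpace 𝓘(ℝ, E) x}
    (hV : ContMDiff 𝓘(ℝ, E) 𝓘(ℝ, E).tangent 1 (fun x => (⟨x, V x⟩ : TangentBundle 𝓘(ℝ, E) N)))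
    (p : N) {ε₀ : ℝ} (hε₀ : 0 < ε₀)
    (h0 : ∃ c : ℝ → N, c 0 = p ∧ IsMIntegralCurveOn c V (Ioo (-ε₀) ε₀))
    (H : ∀ b : ℝ, ∃ ε > 0, ∀ (a : ℝ) (c : ℝ → N) (t : ℝ), c 0 = p →
      IsMIntegralCurveOn c V (Ioo (-a) a) → t ∈ Ioo (-a) a → t ∈ Ioo (b - ε) (b + ε) →
      ∃ c' : ℝ → N, c t = c' t ∧ IsMIntegralCurveOn c' V (Ioo (b - ε) (b + ε))) :
    ∃ c : ℝ → N, c 0 = p ∧ IsMIntegralCurve c V := by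
  let S := {a | ∃ c : ℝ → N, c 0 = p ∧ IsMIntegralCurveOn c V (Ioo (-a) a)}
  suffices hbdd : ¬BddAbove S by
    rw [not_bddAbove_iff] at hbdd
    rw [exists_isMIntegralCurve_iff_exists_isMIntegralCurveOn_Ioo hV]
    intro a
    obtain ⟨y, ⟨c, hc1, hc2⟩, hlt⟩ := hbdd a
    exact ⟨c, hc1, hc2.mono (Ioo_subset_Ioo (neg_le_neg hlt.le) hlt.le)⟩
  -- If the symmetric intervals of existence had a finite supremum `b`, continuing past `b` and past
  -- `-b` would exceed it.
  intro hbdd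
  set b := sSup S with hb
  have hb0 : ε₀ ≤ b := le_csSup hbdd h0
  obtain ⟨ε₁, hε₁, H₁⟩ := H b
  obtain ⟨ε₂, hε₂, H₂⟩ := H (-b)
  -- One `ε` serves both ends; `ε ≤ b` makes the gluing time `t > b - ε` positive.
  obtain ⟨ε, hε, h1, h2, h3⟩ : ∃ ε > 0, ε ≤ ε₁ ∧ ε ≤ ε₂ ∧ ε ≤ b :=
    ⟨min ε₁ (min ε₂ b), lt_min hε₁ (lt_min hε₂ (hε₀.trans_le hb0)), min_le_left _ _,
      (min_le_right _ _).trans (min_le_left _ _), (min_le_right _ _).trans (min_le_right _ _)⟩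
  obtain ⟨a, ⟨c, hc0, hc⟩, ha⟩ := exists_lt_of_lt_csSup (⟨ε₀, h0⟩ : S.Nonempty)
    (show b - ε < sSup S by linarith)
  have hab : a ≤ b := le_csSup hbdd ⟨c, hc0, hc⟩
  obtain ⟨t, ht1, ht2⟩ := exists_between ha
  have hta : t ∈ Ioo (-a) a := ⟨by linarith, ht2⟩
  have hta' : -t ∈ Ioo (-a) a := ⟨by linarith, by linarith⟩
  have htb : t ∈ Ioo (b - ε₁) (b + ε₁) := ⟨by linarith, by linarith⟩
  have htb' : -t ∈ Ioo (-b - ε₂) (-b + ε₂) := ⟨by linarith, by linarith⟩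
  obtain ⟨c₁, e₁, hc₁⟩ := H₁ a c t hc0 hc hta htb
  obtain ⟨c₂, e₂, hc₂⟩ := H₂ a c (-t) hc0 hc hta' htb'
  have hd : IsMIntegralCurveOn (piecewise (Ioo (-a) a) c c₁) V (Ioo (-a) (b + ε)) := by
    refine (isMIntegralCurveOn_piecewise hV hc hc₁ ⟨hta, htb⟩ e₁).mono ?_
    rintro τ ⟨h4, h5⟩
    by_cases h6 : τ < a
    · exact Or.inl ⟨h4, h6⟩
    · exact Or.inr ⟨by linarith, by linarith⟩
  have hta'' : -t ∈ Ioo (-a) (b + ε) := ⟨by linarith, by linarith⟩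
  have hd' := isMIntegralCurveOn_piecewise hV hd hc₂ ⟨hta'', htb'⟩
    ((piecewise_eq_of_mem _ _ _ hta').trans e₂)
  have hmem : b + ε ∈ S := by
    refine ⟨_, ?_, hd'.mono ?_⟩
    · exact (piecewise_eq_of_mem _ _ _ (show (0 : ℝ) ∈ Ioo (-a) (b + ε) from
        ⟨by linarith, by linarith⟩)).trans ((piecewise_eq_of_mem _ _ _
        (show (0 : ℝ) ∈ Ioo (-a) a from ⟨by linarith, by linarith⟩)).trans hc0)
    · rintro τ ⟨h4, h5⟩
      by_cases h6 : -a < τ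
      · exact Or.inl ⟨h6, h5⟩
      · exact Or.inr ⟨by linarith, by linarith⟩
  have := le_csSup hbdd hmem
  linarith

end Gluing

/-! ### One-parameter subgroups of a Lie group. -/

section OneParameter

open Filter Topology Set

variable {E : Type*} [NormedAddCommGroup E] [NormedSpace ℝ E]
  {K : Type*} [TopologicalSpace K] [ChartedSpace E K] [Group K] [LieGroup 𝓘(ℝ, E) ∞ K]

/-- The left-invariant field at `g` is the derivative of multiplication at `(g, 1)` applied to `(0,
X)`, hence a composition of smooth maps. -/
theorem contMDiff_mulInvariantVectorField_infty (X : GroupLieAlgebra 𝓘(ℝ, E) K) :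
    ContMDiff 𝓘(ℝ, E) 𝓘(ℝ, E).tangent ∞
      (fun g : K => (⟨g, mulInvariantVectorField X g⟩ : TangentBundle 𝓘(ℝ, E) K)) := by
  let fg : K → TangentBundle 𝓘(ℝ, E) K := fun g => TotalSpace.mk' E g 0
  have sfg : ContMDiff 𝓘(ℝ, E) 𝓘(ℝ, E).tangent ∞ fg := contMDiff_zeroSection _ _
  let fv : K → TangentBundle 𝓘(ℝ, E) K := fun _ => TotalSpace.mk' E 1 X
  have sfv : ContMDiff 𝓘(ℝ, E) 𝓘(ℝ, E).tangent ∞ fv := contMDiff_const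
  let F₂ : (TangentBundle 𝓘(ℝ, E) K × TangentBundle 𝓘(ℝ, E) K) →
      TangentBundle (𝓘(ℝ, E).prod 𝓘(ℝ, E)) (K × K) :=
    (equivTangentBundleProd 𝓘(ℝ, E) K 𝓘(ℝ, E) K).symm
  have S₂ : ContMDiff (𝓘(ℝ, E).tangent.prod 𝓘(ℝ, E).tangent) (𝓘(ℝ, E).prod 𝓘(ℝ, E)).tangent ∞ F₂ :=
    contMDiff_equivTangentBundleProd_symm
  let F₃ : TangentBundle (𝓘(ℝ, E).prod 𝓘(ℝ, E)) (K × K) → TangentBundle 𝓘(ℝ, E) K :=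
    tangentMap (𝓘(ℝ, E).prod 𝓘(ℝ, E)) 𝓘(ℝ, E) (fun p : K × K => p.1 * p.2)
  have S₃ : ContMDiff (𝓘(ℝ, E).prod 𝓘(ℝ, E)).tangent 𝓘(ℝ, E).tangent ∞ F₃ :=
    (contMDiff_mul 𝓘(ℝ, E) ∞).contMDiff_tangentMap (m := ∞) (by simp)
  have S := (S₃.comp S₂).comp (sfg.prodMk sfv)
  refine S.congr fun g => ?_
  have e := mfderiv_prod_eq_add_apply (p := (g, (1 : K)))
    (v := ((0 : E), (show E from X)))
    ((contMDiff_mul 𝓘(ℝ, E) (G := K) ∞).mdifferentiableAt (by simp))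
  have hpair : ∀ (h : K) (w w' : E), g = h → w = w' →
      (⟨g, w⟩ : TangentBundle 𝓘(ℝ, E) K) = ⟨h, w'⟩ := by
    rintro _ w _ rfl rfl
    rfl
  refine hpair _ _ _ (mul_one g).symm ?_
  refine Eq.symm (e.trans ?_)
  exact (congrArg (fun w : E => w + (show E from mulInvariantVectorField X g)) (map_zero _)).trans
    (zero_add _)

/-- One-parameter subgroups. -/
theorem exists_oneParameterSubgroup [FiniteDimensional ℝ E] (X : GroupLieAlgebra 𝓘(ℝ, E) K) :
    ∃ k : ℝ → K, ContMDiff 𝓘(ℝ, ℝ) 𝓘(ℝ, E) ∞ k ∧ k 0 = 1 ∧ (∀ s t, k (s + t) = k s * k t) ∧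
      HasMFDerivAt 𝓘(ℝ, ℝ) 𝓘(ℝ, E) k 0
        ((1 : ℝ →L[ℝ] ℝ).smulRight (show E from X) : ℝ →L[ℝ] E) := by
  have : IsManifold 𝓘(ℝ, E) 1 K := IsManifold.of_le (n := ∞) (by norm_cast)
  have : IsTopologicalGroup K := topologicalGroup_of_lieGroup 𝓘(ℝ, E) ∞
  -- `K` is not assumed Hausdorff, but a T1 topological group is; uniqueness of integral curves uses
  -- this.
  have : T1Space K := ChartedSpace.t1Space E K
  have hV := contMDiff_mulInvariantVectorField_infty X
  have hV1 := hV.of_le (m := 1) (by norm_cast)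
  have htrans : ∀ (g : K) (c : ℝ → K) (t : ℝ),
      HasVelocityAt E c (mulInvariantVectorField X (c t)) t →
      HasVelocityAt E (fun t => g * c t) (mulInvariantVectorField X (g * c t)) t := by
    intro g c t hc
    have hmul : ∀ g h : K, MDifferentiableAt 𝓘(ℝ, E) 𝓘(ℝ, E) (fun x : K => g * x) h := fun g h =>
      (contMDiff_mul_left (I := 𝓘(ℝ, E)) (n := ∞) (a := g)).mdifferentiableAt (by simp)
    have h1 := hc.comp rfl (hmul g (c t)).hasMFDerivAt
    have h2 : (mfderiv 𝓘(ℝ, E) 𝓘(ℝ, E) (fun x : K => g * x) (c t)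
        (show E from mulInvariantVectorField X (c t)) : E)
        = (mulInvariantVectorField X (g * c t) : E) := by
      have h0 : ∀ h, h = c t → HasMFDerivAt 𝓘(ℝ, E) 𝓘(ℝ, E) (fun x : K => g * x) h
          (mfderiv 𝓘(ℝ, E) 𝓘(ℝ, E) (fun x : K => g * x) (c t) : E →L[ℝ] E) := by
        rintro _ rfl
        exact (hmul _ _).hasMFDerivAt
      have h3 := HasMFDerivAt.comp (1 : K) (h0 (c t * 1) (mul_one _)) (hmul (c t) 1).hasMFDerivAt
      have h4 : (fun x : K => g * x) ∘ (fun x : K => c t * x) = fun x => (g * c t) * x := by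
        ext x; simp [mul_assoc]
      rw [h4] at h3
      have h5 := hasMFDerivAt_unique h3 (hmul (g * c t) 1).hasMFDerivAt
      exact congrArg (fun L : E →L[ℝ] E => L X) h5
    exact (show (_ : E) = _ from h2) ▸ h1
  obtain ⟨c, hc0, hc⟩ := exists_isMIntegralCurveAt_of_contMDiffAt_boundaryless (t₀ := 0)
    (hV1 (1 : K))
  obtain ⟨ε, hε, hc⟩ := isMIntegralCurveAt_iff'.1 hc
  -- Left translates of one local solution through `1` give the same existence time `ε` at every
  -- point, so the field is complete.
  obtain ⟨k, hk0, hk⟩ := exists_isMIntegralCurve_of_isMIntegralCurveOn hV1 hε (fun g =>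
    ⟨fun t => g * c t, by simp [hc0], isMIntegralCurveOn_of_hasVelocityAt fun t ht =>
      htrans g c t (hasVelocityAt_of_isMIntegralCurveOn hc Metric.isOpen_ball (by
        rw [Real.ball_eq_Ioo]; simpa using ht))⟩) (1 : K)
  refine ⟨k, fun t => contMDiffAt_of_isMIntegralCurveAt hV (hk.isMIntegralCurveAt t), hk0, ?_, ?_⟩
  · intro s t
    -- Both `t ↦ k s * k t` and `t ↦ k (t + s)` are integral curves starting at `k s`.
    have h1 : IsMIntegralCurve (fun t => k s * k t)
        (mulInvariantVectorField (I := 𝓘(ℝ, E)) X) := fun t => htrans (k s) k t (hk t)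
    have h2 := isMIntegralCurve_Ioo_eq_of_contMDiff_boundaryless (t₀ := 0) hV1
      (hk.comp_add s) h1 (by simp [hk0])
    rw [add_comm]
    exact congrFun h2 t
  · have h1 : HasVelocityAt E k (mulInvariantVectorField X (k 0)) 0 := hk 0
    have h2 : (mulInvariantVectorField X (1 : K) : E) = (show E from X) := by
      have e : (fun x : K => 1 * x) = id := funext fun x => one_mul x
      have e' : HasMFDerivAt 𝓘(ℝ, E) 𝓘(ℝ, E) (fun x : K => 1 * x) 1
          (ContinuousLinearMap.id ℝ E) := by
        rw [e]
        exact hasMFDerivAt_id (1 : K)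
      exact congrArg (fun L : E →L[ℝ] E => L X) e'.mfderiv
    rw [hk0] at h1
    exact h2 ▸ h1

end OneParameter

end PrincipalComplex

namespace PrincipalComplex

/-! ### Geodesic completeness and completeness of the standard horizontal fields. -/

section Completeness

open Filter Topology Set

set_option linter.unusedSectionVars false

variable {EK EM EP : Type*}
  [NormedAddCommGroup EK] [NormedSpace ℝ EK] [FiniteDimensional ℝ EK]
  [NormedAddCommGroup EM] [NormedSpace ℝ EM]
  [NormedAddCommGroup EP] [NormedSpace ℝ EP] [FiniteDimensional ℝ EP]
  {K M P : Type*} [TopologicalSpace K] [ChartedSpace EK K] [Group K] [IsManifold 𝓘(ℝ, EK) ∞ K]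
  [TopologicalSpace M] [ChartedSpace EM M] [IsManifold 𝓘(ℝ, EM) ∞ M]
  [TopologicalSpace P] [ChartedSpace EP P] [IsManifold 𝓘(ℝ, EP) ∞ P]
  [MulAction Kᵐᵒᵖ P] {pr : P → M} {θ α : LieForm EK EP K P}

/-- Equivariance of both forms: `R_k` preserves horizontality and multiplies `α` by `Ad k⁻¹`. -/
theorem rightTranslation_alphaInv (hθ : θ.IsConnection)
    (hα : α.IsTensorial EM pr) (hiso : ∀ p, Function.Bijective (restrictHorizontal θ α p))
    (p : P) (k : K) (X : GroupLieAlgebra 𝓘(ℝ, EK) K) :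
    rightTranslation EP k p (alphaInv θ α hiso p X) = alphaInv θ α hiso (p <• k) (Ad k⁻¹ X) := by
  apply eq_alphaInv
  · rw [hθ.typeAd, theta_alphaInv, map_zero]
  · rw [hα.typeAd, alpha_alphaInv]

theorem hasVelocityAt_action (hpr : IsPrincipalBundle EK EM EP K pr) (hθ : θ.IsConnection)
    (hα : α.IsTensorial EM pr) (hiso : ∀ p, Function.Bijective (restrictHorizontal θ α p))
    {c : ℝ → P} {t : ℝ} {X : GroupLieAlgebra 𝓘(ℝ, EK) K} (k : K)
    (hc : HasVelocityAt EP c (alphaInv θ α hiso (c t) X) t) :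
    HasVelocityAt EP (fun τ => c τ <• k) (alphaInv θ α hiso (c t <• k) (Ad k⁻¹ X)) t := by
  rw [← rightTranslation_alphaInv hθ hα hiso]
  exact hc.comp rfl (mdifferentiableAt_rightAction hpr k (c t)).hasMFDerivAt

theorem hasVelocityAt_proj (hpr : IsPrincipalBundle EK EM EP K pr) {c : ℝ → P} {t : ℝ}
    {v : TangentSpace 𝓘(ℝ, EP) (c t)} (hc : HasVelocityAt EP c v t) :
    HasVelocityAt EM (fun τ => pr (c τ)) (mfderiv 𝓘(ℝ, EP) 𝓘(ℝ, EM) pr (c t) v) t :=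
  hc.comp rfl (hpr.smooth_proj.mdifferentiable (by simp) (c t)).hasMFDerivAt

theorem alphaInv_proj_injective (hα : α.IsTensorial EM pr)
    (hiso : ∀ p, Function.Bijective (restrictHorizontal θ α p)) {p : P}
    {X Y : GroupLieAlgebra 𝓘(ℝ, EK) K}
    (h : mfderiv 𝓘(ℝ, EP) 𝓘(ℝ, EM) pr p (alphaInv θ α hiso p X)
      = mfderiv 𝓘(ℝ, EP) 𝓘(ℝ, EM) pr p (alphaInv θ α hiso p Y)) : X = Y := by
  have h1 := hα.vertical p (alphaInv θ α hiso p X - alphaInv θ α hiso p Y) (by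
    rw [map_sub, h, sub_self])
  rwa [map_sub, alpha_alphaInv, alpha_alphaInv, sub_eq_zero] at h1

variable [FiniteDimensional ℝ EM]

/-- Every geodesic is, near a given time, the projection of an integral curve of a standard
horizontal vector field. -/
theorem exists_initial_condition (hpr : IsPrincipalBundle EK EM EP K pr) (hθ : θ.IsConnection)
    (hα : α.IsTensorial EM pr) (hiso : ∀ p, Function.Bijective (restrictHorizontal θ α p))
    (B : AdInner EK K)
    (hd : ∀ (p : P) (u v : TangentSpace 𝓘(ℝ, EP) p), covExtDer θ α p u v = 0)
    {γ : ℝ → M} {s : Set ℝ} {t : ℝ} (hs : IsOpen s) (ht : t ∈ s)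
    (hγ : IsGeodesicOn (inducedMetric hpr α B) γ s) :
    ∃ (q : P) (X : GroupLieAlgebra 𝓘(ℝ, EK) K), pr q = γ t ∧ ∀ c : ℝ → P, c t = q →
      IsMIntegralCurveAt c (fun p => alphaInv θ α hiso p X) t → pr ∘ c =ᶠ[𝓝 t] γ := by
  obtain ⟨q, hq⟩ := hpr.surjective (γ t)
  have hx := mem_extChartAt_source (I := 𝓘(ℝ, EM)) (pr q)
  -- `u` is the velocity of `γ` at `t` and `v` a lift of it. For `X = α v`, the horizontal vector
  -- `α⁻¹ X` also projects to `u`.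
  obtain ⟨u, hu⟩ := exists_mfderiv_extChartAt_eq hx (deriv (extChartAt 𝓘(ℝ, EM) (pr q) ∘ γ) t)
  obtain ⟨v, rfl⟩ := hpr.mfderiv_surjective q u
  refine ⟨q, α.toFun q v, hq, fun c hcq hc => ?_⟩
  obtain ⟨ε, hε, hc'⟩ := isMIntegralCurveAt_iff'.1 hc
  have hgeo := isGeodesicOn_proj hpr hθ hα hiso B hd Metric.isOpen_ball hc'
  refine IsGeodesicOn.eventuallyEq (x₀ := pr q)
    (isSmoothMetric_inducedMetric hpr hθ hα hiso B) (hgeo.mono inter_subset_right)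
    (hγ.mono inter_subset_left) (hs.inter Metric.isOpen_ball) ⟨ht, Metric.mem_ball_self hε⟩
    (by rw [Function.comp_apply, hcq, hq]) (by rw [Function.comp_apply, hcq]; exact hx) ?_
  rw [← hu]
  subst hcq
  have h1 : HasVelocityAt EP c (alphaInv θ α hiso (c t) (α.toFun (c t) v)) t := hc.hasMFDerivAt
  have h2 := hasVelocityAt_proj hpr h1
  rw [mfderiv_pr_alphaInv hpr hθ hα hiso] at h2
  exact (hasDerivAt_extChartAt_comp h2 hx).deriv

variable [T2Space M] [T2Space P]

theorem geodesicallyComplete_of_integralCurves (hpr : IsPrincipalBundle EK EM EP K pr)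
    (hθ : θ.IsConnection)
    (hα : α.IsTensorial EM pr) (hiso : ∀ p, Function.Bijective (restrictHorizontal θ α p))
    (B : AdInner EK K)
    (hd : ∀ (p : P) (u v : TangentSpace 𝓘(ℝ, EP) p), covExtDer θ α p u v = 0)
    (h : ∀ (X : GroupLieAlgebra 𝓘(ℝ, EK) K) (p : P), ∃ c : ℝ → P, c 0 = p ∧
      IsMIntegralCurve c (fun p => alphaInv θ α hiso p X)) :
    GeodesicallyComplete (inducedMetric hpr α B) := by
  rintro s γ hs hs' ⟨t, ht⟩ hγ
  obtain ⟨q, X, -, hqX⟩ := exists_initial_condition hpr hθ hα hiso B hd hs ht hγ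
  obtain ⟨c, hc0, hc⟩ := h X q
  have hc' := hc.comp_add (-t)
  have hgeo := isGeodesicOn_proj hpr hθ hα hiso B hd isOpen_univ (hc'.isMIntegralCurveOn univ)
  refine ⟨_, hgeo, ?_⟩
  exact (hgeo.mono (subset_univ s)).eqOn (isSmoothMetric_inducedMetric hpr hθ hα hiso B) hγ hs
    hs'.isPreconnected ht (hqX _ (by simp [hc0]) (hc'.isMIntegralCurveAt t))

/-- All integral curves through `p` lie over one global geodesic `γ`, and local horizontal lifts of
`γ` continue them. -/
theorem integralCurves_of_geodesicallyComplete (hpr : IsPrincipalBundle EK EM EP K pr)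
    (hθ : θ.IsConnection)
    (hα : α.IsTensorial EM pr) (hiso : ∀ p, Function.Bijective (restrictHorizontal θ α p))
    (B : AdInner EK K)
    (hd : ∀ (p : P) (u v : TangentSpace 𝓘(ℝ, EP) p), covExtDer θ α p u v = 0)
    (h : GeodesicallyComplete (inducedMetric hpr α B))
    (X : GroupLieAlgebra 𝓘(ℝ, EK) K) (p : P) : ∃ c : ℝ → P, c 0 = p ∧
      IsMIntegralCurve c (fun p => alphaInv θ α hiso p X) := by
  have : IsManifold 𝓘(ℝ, EP) 1 P := IsManifold.of_le (n := ∞) (by norm_cast)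
  have hg := isSmoothMetric_inducedMetric hpr hθ hα hiso B
  have hV : ∀ X, ContMDiff 𝓘(ℝ, EP) 𝓘(ℝ, EP).tangent 1
      (fun p => (⟨p, alphaInv θ α hiso p X⟩ : TangentBundle 𝓘(ℝ, EP) P)) :=
    fun X => (contMDiff_alphaInv hpr hθ hα hiso X).of_le (by norm_cast)
  obtain ⟨c₀, hc₀, hc₀'⟩ := exists_isMIntegralCurveAt_of_contMDiffAt_boundaryless (t₀ := 0)
    (hV X p)
  obtain ⟨ε₀, hε₀, hc₀''⟩ := isMIntegralCurveAt_iff'.1 hc₀'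
  rw [Real.ball_eq_Ioo, zero_sub, zero_add] at hc₀''
  obtain ⟨γ, hγ, hγc⟩ := h (Ioo (-ε₀) ε₀) (pr ∘ c₀) isOpen_Ioo ordConnected_Ioo
    ⟨0, by simpa using hε₀⟩ (isGeodesicOn_proj hpr hθ hα hiso B hd isOpen_Ioo hc₀'')
  have hproj : ∀ (a : ℝ) (c : ℝ → P), c 0 = p → 0 < a →
      IsMIntegralCurveOn c (fun p => alphaInv θ α hiso p X) (Ioo (-a) a) →
      EqOn (pr ∘ c) γ (Ioo (-a) a) := by
    intro a c hc0 ha hc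
    have h0 : (0 : ℝ) ∈ Ioo (-a) a := ⟨by linarith, ha⟩
    refine (isGeodesicOn_proj hpr hθ hα hiso B hd isOpen_Ioo hc).eqOn hg
      (hγ.mono (subset_univ _)) isOpen_Ioo isPreconnected_Ioo h0 ?_
    have h1 := isMIntegralCurveAt_eventuallyEq_of_contMDiffAt_boundaryless (hV X (c 0))
      (hc.isMIntegralCurveAt (isOpen_Ioo.mem_nhds h0)) hc₀' (hc0.trans hc₀.symm)
    filter_upwards [h1, Ioo_mem_nhds (neg_lt_zero.2 hε₀) hε₀] with τ h2 h3
    rw [Function.comp_apply, h2]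
    exact (hγc h3).symm
  refine exists_isMIntegralCurve_of_extension (hV X) p hε₀ ⟨c₀, hc₀, hc₀''⟩ fun b => ?_
  -- The lift `c₂` of `γ` near `b`, and with it the continuation length, is chosen before any
  -- integral curve `c` is given.
  obtain ⟨q, Y, hq, hqY⟩ := exists_initial_condition hpr hθ hα hiso B hd isOpen_univ (mem_univ b) hγ
  obtain ⟨c₂, hc₂, hc₂'⟩ := exists_isMIntegralCurveAt_of_contMDiffAt_boundaryless (t₀ := b)
    (hV Y q)
  obtain ⟨ε₁, hε₁, hc₂''⟩ := isMIntegralCurveAt_iff'.1 hc₂'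
  obtain ⟨ε₂, hε₂, hc₂γ⟩ := Metric.eventually_nhds_iff_ball.1 (hqY c₂ hc₂ hc₂')
  refine ⟨min ε₁ ε₂, lt_min hε₁ hε₂, fun a c t hc0 hc hta htb => ?_⟩
  rw [← Real.ball_eq_Ioo] at htb ⊢
  have hb₁ : Metric.ball b (min ε₁ ε₂) ⊆ Metric.ball b ε₁ := Metric.ball_subset_ball (min_le_left _ _)
  have hb₂ : Metric.ball b (min ε₁ ε₂) ⊆ Metric.ball b ε₂ :=
    Metric.ball_subset_ball (min_le_right _ _)
  have hcγ := hproj a c hc0 (by linarith [hta.1, hta.2]) hc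
  obtain ⟨k, hk⟩ : ∃ k : K, c t = c₂ t <• k :=
    hpr.exists_action_eq ((hcγ hta).trans (hc₂γ t (hb₂ htb)).symm)
  have hvel : ∀ τ ∈ Metric.ball b ε₁, HasVelocityAt EP (fun τ => c₂ τ <• k)
      (alphaInv θ α hiso (c₂ τ <• k) (Ad k⁻¹ Y)) τ := fun τ hτ =>
    hasVelocityAt_action hpr hθ hα hiso k
      (hasVelocityAt_of_isMIntegralCurveOn hc₂'' Metric.isOpen_ball hτ)
  -- `c` and the translate of `c₂` by `k` meet at time `t` and have the same projection near it.
  -- Their horizontal velocities therefore agree there, and `α` recovers the generators.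
  have hXY : X = Ad k⁻¹ Y := by
    have h1 := hasVelocityAt_proj hpr (hasVelocityAt_of_isMIntegralCurveOn hc isOpen_Ioo hta)
    have h2 := hasVelocityAt_proj hpr (hvel t (hb₁ htb))
    have h3 : (fun τ => pr (c τ)) =ᶠ[𝓝 t] fun τ => pr (c₂ τ <• k) := by
      filter_upwards [isOpen_Ioo.mem_nhds hta, Metric.isOpen_ball.mem_nhds (hb₂ htb)] with τ h4 h5
      rw [hpr.proj_action]
      exact (hcγ h4).trans (hc₂γ τ h5).symm
    have h4 := h1.unique (h2.congr h3)
    refine alphaInv_proj_injective (p := c₂ t <• k) hα hiso ?_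
    rw [← hk] at h4 ⊢
    exact h4
  refine ⟨fun τ => c₂ τ <• k, hk, isMIntegralCurveOn_of_hasVelocityAt fun τ hτ => ?_⟩
  rw [hXY]
  exact hvel τ (hb₁ hτ)

end Completeness

/-! ### Complete integrability and one-parameter subgroups. -/

section Holomorphic

open Filter Topology Set

set_option linter.unusedSectionVars false

variable {EK EM EP : Type*}
  [NormedAddCommGroup EK] [NormedSpace ℝ EK] [FiniteDimensional ℝ EK]
  [NormedAddCommGroup EM] [NormedSpace ℝ EM]
  [NormedAddCommGroup EP] [NormedSpace ℝ EP] [FiniteDimensional ℝ EP]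
  {K M P : Type*} [TopologicalSpace K] [ChartedSpace EK K] [Group K] [LieGroup 𝓘(ℝ, EK) ∞ K]
  [TopologicalSpace M] [ChartedSpace EM M] [IsManifold 𝓘(ℝ, EM) ∞ M]
  [TopologicalSpace P] [ChartedSpace EP P] [IsManifold 𝓘(ℝ, EP) ∞ P]
  [MulAction Kᵐᵒᵖ P] {pr : P → M} {θ α : LieForm EK EP K P}

theorem almostComplex_fundamental (hpr : IsPrincipalBundle EK EM EP K pr) (hθ : θ.IsConnection)
    (hα : α.IsTensorial EM pr) (hiso : ∀ p, Function.Bijective (restrictHorizontal θ α p)) (p : P)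
    (X : GroupLieAlgebra 𝓘(ℝ, EK) K) :
    almostComplex θ α hiso p (fundamental p X) = - alphaInv θ α hiso p X := by
  have h1 := alpha_fundamental hpr hα p X
  have h2 := hθ.fundamental p X
  refine (congrArg₂ (fun a b => fundamental p a - alphaInv θ α hiso p b) h1 h2).trans ?_
  rw [map_zero, zero_sub]

/-- Comparison of imaginary and real parts in the complexification. -/
theorem complexification_eq_iff {V : Type*} [AddCommGroup V] [Module ℝ V] (a b a' b' : V) :
    (1 / 2 : ℂ) • ((1 : ℂ) ⊗ₜ[ℝ] a - Complex.I ⊗ₜ[ℝ] b)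
      = (1 / 2 : ℂ) • ((1 : ℂ) ⊗ₜ[ℝ] a' - Complex.I ⊗ₜ[ℝ] b') ↔ a = a' ∧ b = b' := by
  constructor
  · intro h
    have h1 := smul_right_injective _ (by norm_num : (1 / 2 : ℂ) ≠ 0) h
    have h2 := congrArg (fun x => TensorProduct.lid ℝ V (LinearMap.rTensor V Complex.reLm x)) h1
    have h3 := congrArg (fun x => TensorProduct.lid ℝ V (LinearMap.rTensor V Complex.imLm x)) h1
    simp at h2 h3
    exact ⟨h2, h3⟩
  · rintro ⟨rfl, rfl⟩
    rfl

/-- Real and imaginary parts of the complex equation; the second uses `J X^# = -α⁻¹ X`. -/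
theorem baseChange_ddz_eq_iff (hpr : IsPrincipalBundle EK EM EP K pr) (hθ : θ.IsConnection)
    (hα : α.IsTensorial EM pr) (hiso : ∀ p, Function.Bijective (restrictHorizontal θ α p))
    (X : GroupLieAlgebra 𝓘(ℝ, EK) K) (φ : ℂ → P) (z : ℂ) :
    (mfderiv 𝓘(ℝ, ℂ) 𝓘(ℝ, EP) φ z).toLinearMap.baseChange ℂ (ddz z)
        = (1 / 2 : ℂ) • holField θ α hiso X (φ z) ↔
      (mfderiv 𝓘(ℝ, ℂ) 𝓘(ℝ, EP) φ z (show ℂ from 1) = fundamental (φ z) X ∧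
       mfderiv 𝓘(ℝ, ℂ) 𝓘(ℝ, EP) φ z (show ℂ from Complex.I) = - alphaInv θ α hiso (φ z) X) := by
  rw [← almostComplex_fundamental hpr hθ hα hiso, ← complexification_eq_iff, holField, ddz,
    map_smul, map_sub, LinearMap.baseChange_tmul, LinearMap.baseChange_tmul]
  rfl

theorem integralCurve_of_completelyIntegrable (hpr : IsPrincipalBundle EK EM EP K pr)
    (hθ : θ.IsConnection)
    (hα : α.IsTensorial EM pr) (hiso : ∀ p, Function.Bijective (restrictHorizontal θ α p))
    (X : GroupLieAlgebra 𝓘(ℝ, EK) K) (h : CompletelyIntegrable (holField θ α hiso X)) (p : P) :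
    ∃ c : ℝ → P, c 0 = p ∧ IsMIntegralCurve c (fun p => alphaInv θ α hiso p X) := by
  obtain ⟨φ, hφ, hφ0, hφz⟩ := h p
  -- The imaginary axis is run backwards, to absorb the sign in `-α⁻¹ X`.
  refine ⟨fun y => φ (-(y : ℂ) * Complex.I), by simp [hφ0], fun y => ?_⟩
  have h1 := ((baseChange_ddz_eq_iff hpr hθ hα hiso X φ _).1 (hφz (-(y : ℂ) * Complex.I))).2
  have h2 : HasVelocityAt ℂ (fun y : ℝ => -(y : ℂ) * Complex.I) (-Complex.I) y := by
    have e : HasDerivAt (fun y : ℝ => -(y : ℂ) * Complex.I) (-1 * Complex.I) y :=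
      ((Complex.ofRealCLM.hasDerivAt (x := y)).neg).mul_const Complex.I
    rw [neg_one_mul] at e
    have e' := e.hasFDerivAt.hasMFDerivAt
    convert! e' using 1
  let L : ℂ →L[ℝ] EP := mfderiv 𝓘(ℝ, ℂ) 𝓘(ℝ, EP) φ (-(y : ℂ) * Complex.I)
  have h3 : HasVelocityAt EP (fun y : ℝ => φ (-(y : ℂ) * Complex.I)) (L (-Complex.I)) y :=
    h2.comp rfl (hφ.mdifferentiable (by simp) (-(y : ℂ) * Complex.I)).hasMFDerivAt
  have h4 : L (-Complex.I) = (alphaInv θ α hiso (φ (-(y : ℂ) * Complex.I)) X : EP) :=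
    (map_neg L Complex.I).trans ((congrArg (fun w : EP => -w) h1).trans (neg_neg _))
  rw [h4] at h3
  exact h3

theorem completelyIntegrable_of_integralCurves (hpr : IsPrincipalBundle EK EM EP K pr)
    (hθ : θ.IsConnection)
    (hα : α.IsTensorial EM pr) (hiso : ∀ p, Function.Bijective (restrictHorizontal θ α p))
    (X : GroupLieAlgebra 𝓘(ℝ, EK) K)
    (h : ∀ p : P, ∃ c : ℝ → P, c 0 = p ∧ IsMIntegralCurve c (fun p => alphaInv θ α hiso p X)) :
    CompletelyIntegrable (holField θ α hiso X) := by
  intro p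
  obtain ⟨c, hc0, hc⟩ := h p
  obtain ⟨k, hk, hk0, hkadd, hkX⟩ := exists_oneParameterSubgroup X
  have hcsm : ContMDiff 𝓘(ℝ, ℝ) 𝓘(ℝ, EP) ∞ c := fun t =>
    contMDiffAt_of_isMIntegralCurveAt (contMDiff_alphaInv hpr hθ hα hiso X)
      (hc.isMIntegralCurveAt t)
  have hre : ContMDiff 𝓘(ℝ, ℂ) 𝓘(ℝ, ℝ) ∞ (fun z : ℂ => z.re) :=
    Complex.reCLM.contDiff.contMDiff
  have him : ContMDiff 𝓘(ℝ, ℂ) 𝓘(ℝ, ℝ) ∞ (fun z : ℂ => -z.im) :=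
    Complex.imCLM.contDiff.neg.contMDiff
  set φ : ℂ → P := fun z => c (-z.im) <• k z.re with hφ
  have hφsm : ContMDiff 𝓘(ℝ, ℂ) 𝓘(ℝ, EP) ∞ φ :=
    hpr.smooth_action.comp ((hcsm.comp him).prodMk (hk.comp hre))
  have hinv : ∀ t, (k t)⁻¹ = k (-t) := fun t => by
    rw [inv_eq_iff_mul_eq_one, ← hkadd, add_neg_cancel, hk0]
  -- A one-parameter subgroup is commutative, so conjugation by `(k t)⁻¹` fixes the curve `k`, hence
  -- also its velocity `X` at `0`.
  have hAd : ∀ t, Ad (k t)⁻¹ X = X := by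
    intro t
    have h1 : HasVelocityAt EK k (show EK from X) 0 := hkX
    have hsm : MDifferentiableAt 𝓘(ℝ, EK) 𝓘(ℝ, EK) (fun h : K => (k t)⁻¹ * h * ((k t)⁻¹)⁻¹) 1 :=
      ((contMDiff_mul_right (I := 𝓘(ℝ, EK)) (n := ∞) (a := ((k t)⁻¹)⁻¹)).comp
        (contMDiff_mul_left (I := 𝓘(ℝ, EK)) (n := ∞) (a := (k t)⁻¹))).mdifferentiableAt (by simp)
    have h2 := h1.comp hk0.symm hsm.hasMFDerivAt
    have h3 : (fun τ => (k t)⁻¹ * k τ * ((k t)⁻¹)⁻¹) = k := by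
      ext τ
      rw [inv_inv, hinv, ← hkadd, ← hkadd]
      congr 1
      ring
    rw [h3] at h2
    exact h2.unique h1
  refine ⟨φ, hφsm, by simp [hφ, hk0, hc0], fun z => ?_⟩
  rw [baseChange_ddz_eq_iff hpr hθ hα hiso]
  have hline : ∀ v : ℂ, HasVelocityAt EP (fun t : ℝ => φ (z + t * v))
      (mfderiv 𝓘(ℝ, ℂ) 𝓘(ℝ, EP) φ z (show ℂ from v)) 0 := by
    intro v
    have h2 : HasVelocityAt ℂ (fun t : ℝ => z + t * v) v 0 := by
      have e : HasDerivAt (fun t : ℝ => z + (t : ℂ) * v) (1 * v) 0 :=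
        ((Complex.ofRealCLM.hasDerivAt (x := 0)).mul_const v).const_add z
      rw [one_mul] at e
      have e' := e.hasFDerivAt.hasMFDerivAt
      convert! e' using 1
    exact h2.comp (by simp) (hφsm.mdifferentiable (by simp) z).hasMFDerivAt
  constructor
  · refine (hline 1).unique ?_
    have h1 : HasVelocityAt EK k (show EK from X) 0 := hkX
    have h2 := h1.comp hk0.symm (mdifferentiableAt_action hpr (φ z) 1).hasMFDerivAt
    -- By the homomorphism property, moving in the real direction is the right action of `k`, whose
    -- velocity is `X^#`.
    have h3 : (fun t : ℝ => φ (z + t * 1)) = fun t => φ z <• k t := by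
      ext t
      have e1 : (z + t * 1).re = z.re + t := by simp
      have e2 : (z + t * 1).im = z.im := by simp
      rw [hφ]
      dsimp only
      rw [e1, e2, hkadd]
      exact mul_smul (MulOpposite.op (k t)) (MulOpposite.op (k z.re)) (c (-z.im))
    rw [h3]
    exact h2
  · refine (hline Complex.I).unique ?_
    -- In the imaginary direction `φ` is a right translate of `c` reversed. By `hAd` the translate
    -- is again an integral curve for the same `X`.
    have h1 : HasVelocityAt EP c (alphaInv θ α hiso (c (-z.im)) X) (-z.im) := hc _
    have h2 := hasVelocityAt_action hpr hθ hα hiso (k z.re) h1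
    rw [hAd] at h2
    have e : HasDerivAt (fun t : ℝ => -z.im - t) (-1) 0 := by
      simpa using (hasDerivAt_id (0 : ℝ)).const_sub (-z.im)
    have h3 := h2.comp_hasDerivAt (t := 0) (by simp) e
    have h4 : (fun t : ℝ => φ (z + t * Complex.I)) = fun t => c (-z.im - t) <• k z.re := by
      ext t
      have e1 : (z + t * Complex.I).re = z.re := by simp
      have e2 : -(z + t * Complex.I).im = -z.im - t := by simp; ring
      rw [hφ]
      dsimp only
      rw [e1, e2]
    rw [h4]
    exact (show (_ : EP) = _ from neg_one_smul ℝ _) ▸ h3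

end Holomorphic

end PrincipalComplex

theorem proposition3p1
    {EK EM EP : Type*}
    [NormedAddCommGroup EK] [NormedSpace ℝ EK] [FiniteDimensional ℝ EK]
    [NormedAddCommGroup EM] [NormedSpace ℝ EM] [FiniteDimensional ℝ EM]
    [NormedAddCommGroup EP] [NormedSpace ℝ EP] [FiniteDimensional ℝ EP]
    {K M P : Type*}
    [TopologicalSpace K] [ChartedSpace EK K] [Group K] [LieGroup 𝓘(ℝ, EK) ∞ K]
    [TopologicalSpace M] [T2Space M] [ChartedSpace EM M] [IsManifold 𝓘(ℝ, EM) ∞ M]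
    [TopologicalSpace P] [T2Space P] [ChartedSpace EP P] [IsManifold 𝓘(ℝ, EP) ∞ P]
    [MulAction Kᵐᵒᵖ P]
    (pr : P → M) (hpr : PrincipalComplex.IsPrincipalBundle EK EM EP K pr)
    (θ : PrincipalComplex.LieForm EK EP K P) (hθ : θ.IsConnection)
    (α : PrincipalComplex.LieForm EK EP K P) (hα : α.IsTensorial EM pr)
    (hiso : ∀ p, Function.Bijective (PrincipalComplex.restrictHorizontal θ α p))
    (B : PrincipalComplex.AdInner EK K)
    (hd : ∀ (p : P) (u v : TangentSpace 𝓘(ℝ, EP) p), PrincipalComplex.covExtDer θ α p u v = 0) :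
    (∀ X : GroupLieAlgebra 𝓘(ℝ, EK) K,
      PrincipalComplex.CompletelyIntegrable (PrincipalComplex.holField θ α hiso X)) ↔
    PrincipalComplex.GeodesicallyComplete (PrincipalComplex.inducedMetric hpr α B) := by
  constructor
  · intro h
    exact PrincipalComplex.geodesicallyComplete_of_integralCurves hpr hθ hα hiso B hd fun X =>
      PrincipalComplex.integralCurve_of_completelyIntegrable hpr hθ hα hiso X (h X)
  · intro h X
    exact PrincipalComplex.completelyIntegrable_of_integralCurves hpr hθ hα hiso X
      (PrincipalComplex.integralCurves_of_geodesicallyComplete hpr hθ hα hiso B hd h X)
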